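/- Call a *space* a 2-dimensional $\mathbb{Q}$-vector subspace $V\subset\mathbb{C}$ containing two $\mathbb{R}$-linearly independent vectors. Two nonzero vectors $v_1,v_2\in V$ with $v_2/v_1\notin\mathbb{R}$ form a *rational angle* of $V$ if $\arg(v_2/v_1)$ is a rational multiple of $\pi$. A *rational $n$-tuple* of $V$ is a set of $n$ vectors of $V$ any two of which form a rational angle; two such tuples are *disjoint* if no vector of one is a real multiple of a vector of the other. The space $V$ is of type $n_1+\dots+n_k$ if it contains pairwise disjoint rational tuples of sizes $n_1,\dots,n_k$. Two spaces $V,W$ are *homothetic* if $W=\lambda V$ for some $\lambda\in\mathbb{C}^*$. Write $V(\tau)=\mathbb{Q}+\mathbb{Q}\tau$. **Theorem.** Let $V$ be a space of type $2+2+2$, $3+2$ or $4$. Then at least one of the following holds. 1. $V$ is homothetic to a space $V(\tau)$ of one of the following two families: (a) $\tau$ is a purely imaginary root of $\tau^2+(a-1)\frac{y+1}{y-1}\tau-a=0$, where $a\in\mathbb{Q}\setminus\{0,1,-1\}$ and $y\neq 1$ is a root of unity; (b) $\tau=\frac{y+1}{y-1}$, where $y\neq\pm1$ is a root of unity. 2.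 Every rational angle of $V$ of measure $\frac{a}{b}2\pi$, with $a\in\mathbb{Z}$ and $b\geq 1$ coprime (that is, $v_1,v_2\in V$ form a rational angle and $\arg(v_2/v_1)\equiv\frac{a}{b}2\pi \pmod{2\pi}$), satisfies $$b\leq 2^7\cdot 3^4\cdot 5^3\cdot\Bigl(\prod_{7\leq p\leq 37,\ p\text{ prime}}p\Bigr)^2.$$ -/

import Mathlib

namespace RationalAngles

/-- A *space*: a `2`-dimensional `ℚ`-vector subspace of `ℂ` that contains two
`ℝ`-linearly independent vectors. -/
def IsSpace (V : Submodule ℚ ℂ) : Prop :=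
  Module.finrank ℚ V = 2 ∧ ∃ v ∈ V, ∃ w ∈ V, LinearIndependent ℝ ![v, w]

/-- The nonzero vectors `v`, `w` span distinct real lines and form a *rational angle*:
the argument of `w / v` is a rational multiple of `π`. -/
def IsRationalAngle (v w : ℂ) : Prop :=
  v ≠ 0 ∧ w ≠ 0 ∧ (w / v).im ≠ 0 ∧ ∃ q : ℚ, Complex.arg (w / v) = (q : ℝ) * Real.pi

/-- A *rational `n`-tuple* of `V`: `n` vectors of `V`, any two of which form a rational angle. -/
def IsRationalTuple (V : Submodule ℚ ℂ) {n : ℕ} (v : Fin n → ℂ) : Prop :=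
  (∀ i, v i ∈ V) ∧ ∀ i j, i ≠ j → IsRationalAngle (v i) (v j)

/-- Two tuples of vectors are *disjoint* if no line spanned by a vector of the first is spanned
by a vector of the second: tuples count as subsets of the projective line. -/
def DisjointTuples {n m : ℕ} (v : Fin n → ℂ) (w : Fin m → ℂ) : Prop :=
  ∀ i j, Submodule.span ℝ {v i} ≠ Submodule.span ℝ {w j}

/-- `V` is of type `n 0 + n 1 + ⋯ + n (k - 1)`: it contains rational tuples of these sizes that
are pairwise disjoint. -/
def HasType (V : Submodule ℚ ℂ) {k : ℕ} (n : Fin k → ℕ) : Prop :=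
  ∃ v : (j : Fin k) → Fin (n j) → ℂ,
    (∀ j, IsRationalTuple V (v j)) ∧ ∀ i j, i ≠ j → DisjointTuples (v i) (v j)

/-- `V` is sent to `W` by a homothety `z ↦ c * z`, `c ≠ 0`. -/
def Homothetic (V W : Submodule ℚ ℂ) : Prop :=
  ∃ c : ℂ, c ≠ 0 ∧ V.map (LinearMap.mulLeft ℚ c) = W

/-- The `ℚ`-vector space `V(τ)` generated by `1` and `τ`. -/
noncomputable def spaceOf (τ : ℂ) : Submodule ℚ ℂ := Submodule.span ℚ {1, τ}

/-- `y` is a root of unity. -/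
def IsRootOfUnity (y : ℂ) : Prop := ∃ n : ℕ, 0 < n ∧ y ^ n = 1

/-- The first family: `V(τ)` with `τ` a purely imaginary root of
`τ² + (a - 1) (y + 1) / (y - 1) τ - a = 0`, where `a ≠ 0, ±1` is rational and `y ≠ 1` is a root
of unity. -/
def InFirstFamily (W : Submodule ℚ ℂ) : Prop :=
  ∃ (a : ℚ) (y τ : ℂ), a ≠ 0 ∧ a ≠ 1 ∧ a ≠ -1 ∧ IsRootOfUnity y ∧ y ≠ 1 ∧ τ.re = 0 ∧
    τ ^ 2 + ((a : ℂ) - 1) * ((y + 1) / (y - 1)) * τ - (a : ℂ) = 0 ∧ W = spaceOf τ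

/-- The second family: `V(τ)` with `τ = (y + 1) / (y - 1)`, where `y ≠ ±1` is a root of unity. -/
def InSecondFamily (W : Submodule ℚ ℂ) : Prop :=
  ∃ y : ℂ, IsRootOfUnity y ∧ y ≠ 1 ∧ y ≠ -1 ∧ W = spaceOf ((y + 1) / (y - 1))

end RationalAngles

/-! To a real line spanned by `v` attach `lineArg v = v / conj v`. A rational angle makes the
quotient of two such numbers a root of unity. In a basis `e₁, e₂` of `V` the vectors have rational
coordinates, so each rational angle is an equation over `ℚ`, bilinear in `(T, W) = (e₁, e₂)` and
`(S, R) = (conj e₁, conj e₂)`, with one root of unity as parameter. Adjoining an arbitrary rational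
angle `(v, w)` to the given tuples yields four commensurable lines or three pairs spanning at least
five lines. Eliminating the basis leaves one rational polynomial relation, of degree at most 2 in
each variable, between three roots of unity, the first being attached to `(v, w)`.

Such a relation has at most 27 terms. By a Mann-type argument (`sum_filter_pow_primorial_eq_zero`)
it splits into subsums whose ratios have order dividing `primorial 27`. Geometry of exponents
(`exists_linear_form_or_mem_single`) then either bounds the order of the first root by `48 *
primorial 27`, or deforms the solution to `x j * t ^ α j` with `α 0 ≠ 0`
(`exists_pow_eq_one_or_family`).

It remains to study the deformations. For four commensurable lines, comparing coefficients in `t`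
forces two perpendicular lines, which gives the second family. For three pairs with independent
quadratic forms, the deformation lifts to polynomials `T, W, S, R`, and five lines are too many
(`not_exists_polynomial_family`). If the forms are dependent, the relation is a rational linear
relation between cotangents; a deformation forces one pair to be perpendicular (`cot_family`), and
then `V` lies in the first family. -/

/-! ### Vanishing sums of roots of unity -/

open Polynomial in
-- Galois conjugation: the sum is a rational polynomial evaluated at a primitive `N`-th root `ω`,
-- and `ω ^ s` has the same minimal polynomial, the cyclotomic one.
theorem sum_pow_eq_zero_of_coprime {ι : Type*} (S : Finset ι) (a : ι → ℚ) (ζ : ι → ℂ) {N s : ℕ}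
    (hN : 0 < N) (hs : s.Coprime N) (hζ : ∀ i ∈ S, ζ i ^ N = 1)
    (h : ∑ i ∈ S, (a i : ℂ) * ζ i = 0) : ∑ i ∈ S, (a i : ℂ) * ζ i ^ s = 0 := by
  have hω := Complex.isPrimitiveRoot_exp N hN.ne'
  set ω := Complex.exp (2 * Real.pi * Complex.I / N)
  have hm : ∀ i, ∃ m : ℕ, i ∈ S → ω ^ m = ζ i := by
    intro i
    by_cases hi : i ∈ S
    · have : NeZero N := ⟨hN.ne'⟩
      obtain ⟨m, -, hm⟩ := hω.eq_pow_of_pow_eq_one (hζ i hi)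
      exact ⟨m, fun _ => hm⟩
    · exact ⟨0, fun h => absurd h hi⟩
  choose m hm using hm
  set f : ℚ[X] := ∑ i ∈ S, C (a i) * X ^ m i with hf
  have haeval : ∀ z : ℂ, aeval z f = ∑ i ∈ S, (a i : ℂ) * z ^ m i := by
    intro z
    simp [hf, map_sum]
  have h0 : aeval ω f = 0 := by
    rw [haeval, ← h]
    exact Finset.sum_congr rfl fun i hi => by rw [hm i hi]
  have hd : minpoly ℚ ω ∣ f := minpoly.dvd _ _ h0
  have hs' := hω.pow_of_coprime s hs
  rw [← cyclotomic_eq_minpoly_rat hω hN, cyclotomic_eq_minpoly_rat hs' hN] at hd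
  have h1 : aeval (ω ^ s) f = 0 := by
    obtain ⟨g, hg⟩ := hd
    rw [hg, map_mul, minpoly.aeval, zero_mul]
  rw [haeval] at h1
  rw [← h1]
  exact Finset.sum_congr rfl fun i hi => by rw [← hm i hi, pow_right_comm]

theorem exists_prime_of_not_dvd_primorial {n N : ℕ} (h : ¬ N ∣ primorial n) :
    ∃ p, p.Prime ∧ p ∣ N ∧ (p * p ∣ N ∨ n < p) := by
  by_contra! hc
  apply h
  have hsq : Squarefree N := by
    rw [Nat.squarefree_iff_prime_squarefree]
    intro p hp hd
    exact (hc p hp (dvd_of_mul_left_dvd hd)).1 hd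
  rw [← Nat.prod_primeFactors_of_squarefree hsq]
  apply Finset.prod_dvd_prod_of_subset
  intro p hp
  have hp' := Nat.prime_of_mem_primeFactors hp
  have := (hc p hp' (Nat.dvd_of_mem_primeFactors hp)).2
  simp [hp']
  omega

/-- Conjugation by an exponent `1 + j * q` multiplies a term `ζ` by `(ζ ^ q) ^ j`. Among at most `n`
terms whose `ζ` are `p * q`-th roots of unity, `ζ ^ q` takes at most `min p n` values, so this many
consecutive `j` are what a Vandermonde argument needs. -/
theorem exists_consecutive_coprime {n p q : ℕ} (hp : p.Prime)
    (h : p * p ∣ p * q ∨ n < p) :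
    ∃ j₁ L, (∀ j < L, (1 + (j₁ + j) * q).Coprime (p * q)) ∧ min p n ≤ L := by
  have key : ∀ s, (1 + s * q).Coprime q := fun s => by simp
  by_cases hpq : p ∣ q
  · refine ⟨0, p, fun j _ => Nat.Coprime.mul_right ?_ (key _), min_le_left _ _⟩
    exact Nat.Coprime.coprime_dvd_right hpq (key _)
  · have hn : n < p := by
      rcases h with h | h
      · exact absurd (Nat.dvd_of_mul_dvd_mul_left hp.pos h) hpq
      · exact h
    have := Fact.mk hp
    have hq0 : (q : ZMod p) ≠ 0 := by rwa [Ne, ZMod.natCast_eq_zero_iff]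
    -- Modulo `p` the only bad index is `-1/q`; the `p - 1 ≥ n` indices right after it are good.
    refine ⟨(-(q : ZMod p)⁻¹).val + 1, p - 1, fun j hj => Nat.Coprime.mul_right ?_ (key _), ?_⟩
    · rw [Nat.coprime_comm, hp.coprime_iff_not_dvd, ← ZMod.natCast_eq_zero_iff]
      push_cast
      rw [ZMod.natCast_zmod_val]
      intro h0
      have h1 : ((j + 1 : ℕ) : ZMod p) * q = 0 := by
        have : (1 : ZMod p) + (-(q : ZMod p)⁻¹ + 1 + j) * q = (1 - (q : ZMod p)⁻¹ * q) + (j + 1) * q := by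
          ring
        rw [this, inv_mul_cancel₀ hq0] at h0
        push_cast
        linear_combination h0
      rcases mul_eq_zero.1 h1 with h2 | h2
      · rw [ZMod.natCast_eq_zero_iff] at h2
        have := Nat.le_of_dvd (by omega) h2
        omega
      · exact hq0 h2
    · omega

open Polynomial in
-- Vandermonde by interpolation: the power sums vanish against every polynomial of degree below `L`,
-- in particular against one vanishing at all values of `χ` except `c`.
theorem sum_fiber_eq_zero {ι : Type*} (S : Finset ι) (b χ : ι → ℂ) (L : ℕ)
    (hL : (S.image χ).card ≤ L) (h : ∀ j < L, ∑ i ∈ S, b i * χ i ^ j = 0) (c : ℂ) :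
    ∑ i ∈ S with χ i = c, b i = 0 := by
  by_cases hc : c ∈ S.image χ
  · set f : ℂ[X] := ∏ d ∈ (S.image χ).erase c, (X - C d) with hf
    have hdeg : f.natDegree < L := by
      rw [hf, natDegree_prod_of_monic _ _ fun d _ => monic_X_sub_C d]
      simp only [natDegree_X_sub_C, Finset.sum_const, smul_eq_mul, mul_one]
      rw [Finset.card_erase_of_mem hc]
      have := Finset.card_pos.2 ⟨c, hc⟩
      omega
    have h0 : ∑ i ∈ S, b i * f.eval (χ i) = 0 := by
      simp_rw [eval_eq_sum_range' hdeg, Finset.mul_sum]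
      rw [Finset.sum_comm]
      apply Finset.sum_eq_zero
      intro j hj
      rw [Finset.mem_range] at hj
      calc ∑ i ∈ S, b i * (f.coeff j * χ i ^ j) = f.coeff j * ∑ i ∈ S, b i * χ i ^ j := by
            rw [Finset.mul_sum]; exact Finset.sum_congr rfl fun i _ => by ring
        _ = 0 := by rw [h j hj, mul_zero]
    have h1 : ∑ i ∈ S, b i * f.eval (χ i) = f.eval c * ∑ i ∈ S with χ i = c, b i := by
      rw [Finset.sum_filter, Finset.mul_sum]
      apply Finset.sum_congr rfl
      intro i hi
      split_ifs with hic
      · rw [hic, mul_comm]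
      · have : f.eval (χ i) = 0 := by
          rw [hf, eval_prod]
          exact Finset.prod_eq_zero (Finset.mem_erase.2 ⟨hic, Finset.mem_image_of_mem _ hi⟩)
            (by simp)
        rw [this, mul_zero, mul_zero]
    rw [h1] at h0
    refine (mul_eq_zero.1 h0).resolve_left ?_
    rw [hf, eval_prod]
    refine Finset.prod_ne_zero_iff.2 ?_
    intro d hd
    simp only [eval_sub, eval_X, eval_C]
    exact sub_ne_zero.2 (Finset.ne_of_mem_erase hd).symm
  · apply Finset.sum_eq_zero
    intro i hi
    rw [Finset.mem_filter] at hi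
    exact absurd (hi.2 ▸ Finset.mem_image_of_mem _ hi.1) hc

/-- A vanishing sum of at most `n` rational multiples of roots of unity splits into vanishing
subsums, in each of which the ratios of the roots of unity have order dividing `primorial n`. -/
theorem sum_filter_pow_primorial_eq_zero {ι : Type*} (n N : ℕ) (hN : 0 < N) (S : Finset ι)
    (a : ι → ℚ) (ζ : ι → ℂ) (hS : S.card ≤ n) (hζ : ∀ i ∈ S, ζ i ^ N = 1)
    (h : ∑ i ∈ S, (a i : ℂ) * ζ i = 0) (z : ℂ) :
    ∑ i ∈ S with ζ i ^ primorial n = z, (a i : ℂ) * ζ i = 0 := by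
  induction N using Nat.strong_induction_on generalizing S ζ z with
  | _ N ih =>
  by_cases hd : N ∣ primorial n
  · have h1 : ∀ i ∈ S, ζ i ^ primorial n = 1 := by
      intro i hi
      obtain ⟨k, hk⟩ := hd
      rw [hk, pow_mul, hζ i hi, one_pow]
    by_cases hz : z = 1
    · rw [Finset.filter_true_of_mem fun i hi => by rw [hz, h1 i hi], h]
    · rw [Finset.filter_false_of_mem fun i hi => by rw [h1 i hi]; exact Ne.symm hz,
        Finset.sum_empty]
  obtain ⟨p, hp, ⟨q, rfl⟩, hpn⟩ := exists_prime_of_not_dvd_primorial hd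
  have hq : 0 < q := Nat.pos_of_mul_pos_left hN
  have hqN : q < p * q := by nlinarith [hp.two_le]
  obtain ⟨j₁, L, hcop, hL⟩ := exists_consecutive_coprime (n := n) hp hpn
  have hcard : (S.image fun i => ζ i ^ q).card ≤ L := by
    refine le_trans (le_min ?_ (Finset.card_image_le.trans hS)) hL
    calc (S.image fun i => ζ i ^ q).card ≤ (Polynomial.nthRootsFinset p (1 : ℂ)).card := by
          apply Finset.card_le_card
          intro c hc
          obtain ⟨i, hi, rfl⟩ := Finset.mem_image.1 hc
          rw [Polynomial.mem_nthRootsFinset hp.pos, ← pow_mul, mul_comm, hζ i hi]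
      _ ≤ p := (Multiset.toFinset_card_le _).trans (Polynomial.card_nthRoots p 1)
  -- The conjugates give this with weights `ζ i ^ (1 + j₁ * q)`; the extra factor is the constant `c
  -- ^ j₁` on the fibre.
  have hfib : ∀ c, ∑ i ∈ S with ζ i ^ q = c, (a i : ℂ) * ζ i = 0 := by
    intro c
    have := sum_fiber_eq_zero S (fun i => (a i : ℂ) * ζ i ^ (1 + j₁ * q)) (fun i => ζ i ^ q) L hcard
      (by
        intro j hj
        rw [← sum_pow_eq_zero_of_coprime S a ζ hN (hcop j hj) hζ h]
        exact Finset.sum_congr rfl fun i _ => by ring) c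
    by_cases hc : c = 0
    · apply Finset.sum_eq_zero
      intro i hi
      rw [Finset.mem_filter] at hi
      have h0 : ζ i = 0 := by
        have := hi.2
        rw [hc] at this
        exact pow_eq_zero_iff hq.ne' |>.1 this
      rw [h0, mul_zero]
    have h2 : c ^ j₁ * ∑ i ∈ S with ζ i ^ q = c, (a i : ℂ) * ζ i = 0 := by
      rw [← this, Finset.mul_sum]
      apply Finset.sum_congr rfl
      intro i hi
      rw [Finset.mem_filter] at hi
      rw [← hi.2]; ring
    exact (mul_eq_zero.1 h2).resolve_left (pow_ne_zero _ hc)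
  rw [← Finset.sum_fiberwise_of_maps_to (t := S.image fun i => ζ i ^ q) (g := fun i => ζ i ^ q)
    (fun i hi => Finset.mem_image_of_mem _ (Finset.mem_of_mem_filter i hi))]
  apply Finset.sum_eq_zero
  intro c hc
  obtain ⟨i₀, hi₀, rfl⟩ := Finset.mem_image.1 hc
  have hi0 : ζ i₀ ≠ 0 := by
    intro h0
    have := hζ i₀ hi₀
    rw [h0, zero_pow hN.ne'] at this
    exact zero_ne_one this
  -- Dividing by one member turns a fibre into a vanishing sum of `q`-th roots of unity, with `q`
  -- smaller than the original exponent.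
  have key := ih q hqN hq (S.filter fun i => ζ i ^ q = ζ i₀ ^ q) (fun i => ζ i / ζ i₀)
    ((Finset.card_filter_le _ _).trans hS)
    (by
      intro i hi
      rw [Finset.mem_filter] at hi
      rw [div_pow, hi.2, div_self (pow_ne_zero _ hi0)])
    (by
      have := hfib (ζ i₀ ^ q)
      simp_rw [mul_div_assoc', ← Finset.sum_div, this, zero_div])
    (z / ζ i₀ ^ primorial n)
  simp_rw [mul_div_assoc', ← Finset.sum_div] at key
  rw [div_eq_zero_iff] at key
  rw [← key.resolve_right hi0, Finset.filter_filter, Finset.filter_filter]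
  apply Finset.sum_congr _ fun _ _ => rfl
  ext i
  simp only [Finset.mem_filter, div_pow, div_left_inj' (pow_ne_zero (primorial n) hi0)]
  tauto

/-! ### Polynomial relations between three roots of unity -/

theorem abs_mul_mul_le_eight {a b c : ℤ} (ha : |a| ≤ 2) (hb : |b| ≤ 2) (hc : |c| ≤ 2) :
    |a * b * c| ≤ 8 := by
  rw [abs_mul, abs_mul]
  calc |a| * |b| * |c| ≤ 2 * 2 * 2 := by gcongr
    _ = 8 := by norm_num

theorem abs_mul_le_four {a b : ℤ} (ha : |a| ≤ 2) (hb : |b| ≤ 2) : |a * b| ≤ 4 := by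
  rw [abs_mul]
  calc |a| * |b| ≤ 2 * 2 := by gcongr
    _ = 4 := by norm_num

/-- Either some integral linear form with nonzero first coefficient kills all the small vectors
of a subgroup of `ℤ³`, or the subgroup contains a small multiple of the first basis vector. -/
theorem exists_linear_form_or_mem_single (H : AddSubgroup (Fin 3 → ℤ)) :
    (∃ α : Fin 3 → ℤ, α 0 ≠ 0 ∧ ∀ d ∈ H, (∀ i, |d i| ≤ 2) →
      α 0 * d 0 + α 1 * d 1 + α 2 * d 2 = 0) ∨
    ∃ m : ℕ, 0 < m ∧ m ≤ 48 ∧ ![(m : ℤ), 0, 0] ∈ H := by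
  have fin : ∀ m : ℤ, m ≠ 0 → |m| ≤ 48 → ![m, 0, 0] ∈ H →
      ∃ m : ℕ, 0 < m ∧ m ≤ 48 ∧ ![(m : ℤ), 0, 0] ∈ H := by
    intro m hm hm' h
    refine ⟨m.natAbs, Int.natAbs_pos.2 hm, by rw [abs_le] at hm'; omega, ?_⟩
    rcases Int.natAbs_eq m with h1 | h1
    · rwa [← h1]
    · have : ![(m.natAbs : ℤ), 0, 0] = -![m, 0, 0] := by
        ext i; fin_cases i <;> simp; omega
      rw [this]
      exact H.neg_mem h
  -- The question is whether the rational span of the small vectors contains the first basis vector.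
  -- If three of them are independent, Cramer's rule puts their determinant times this vector in
  -- `H`; the bound 48 is six products of absolute value at most 8.
  by_cases h3 : ∃ d ∈ H, ∃ e ∈ H, ∃ f ∈ H, (∀ i, |d i| ≤ 2) ∧ (∀ i, |e i| ≤ 2) ∧
      (∀ i, |f i| ≤ 2) ∧ (e 1 * f 2 - e 2 * f 1) * d 0 + (f 1 * d 2 - f 2 * d 1) * e 0 +
        (d 1 * e 2 - d 2 * e 1) * f 0 ≠ 0
  · right
    obtain ⟨d, hd, e, he, f, hf, bd, be, bf, h⟩ := h3
    refine fin _ h ?_ ?_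
    · have h1 := abs_le.1 (abs_mul_mul_le_eight (be 1) (bf 2) (bd 0))
      have h2 := abs_le.1 (abs_mul_mul_le_eight (be 2) (bf 1) (bd 0))
      have h3 := abs_le.1 (abs_mul_mul_le_eight (bf 1) (bd 2) (be 0))
      have h4 := abs_le.1 (abs_mul_mul_le_eight (bf 2) (bd 1) (be 0))
      have h5 := abs_le.1 (abs_mul_mul_le_eight (bd 1) (be 2) (bf 0))
      have h6 := abs_le.1 (abs_mul_mul_le_eight (bd 2) (be 1) (bf 0))
      rw [abs_le]
      constructor <;> linarith
    · convert H.add_mem (H.add_mem (H.zsmul_mem hd (e 1 * f 2 - e 2 * f 1))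
        (H.zsmul_mem he (f 1 * d 2 - f 2 * d 1))) (H.zsmul_mem hf (d 1 * e 2 - d 2 * e 1)) using 1
      ext i; fin_cases i <;> simp <;> ring
  push Not at h3
  by_cases h2 : ∃ d ∈ H, ∃ e ∈ H, (∀ i, |d i| ≤ 2) ∧ (∀ i, |e i| ≤ 2) ∧
      d 1 * e 2 - d 2 * e 1 ≠ 0
  · left
    obtain ⟨d, hd, e, he, bd, be, h⟩ := h2
    -- The cross product of `d` and `e`; it kills a third small vector because all the determinants
    -- vanish.
    refine ⟨![d 1 * e 2 - d 2 * e 1, d 2 * e 0 - d 0 * e 2, d 0 * e 1 - d 1 * e 0], h, ?_⟩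
    intro f hf bf
    have := h3 d hd e he f hf bd be bf
    simp
    linear_combination this
  push Not at h2
  have two : ∀ d ∈ H, ∀ e ∈ H, (∀ i, |d i| ≤ 2) → (∀ i, |e i| ≤ 2) → ∀ j,
      d j * e 0 - e j * d 0 ≠ 0 → ![d j * e 0 - e j * d 0, 0, 0] ∈ H →
      ∃ m : ℕ, 0 < m ∧ m ≤ 48 ∧ ![(m : ℤ), 0, 0] ∈ H := by
    intro d _ e _ bd be j hj hm
    refine fin _ hj ?_ hm
    have h1 := abs_le.1 (abs_mul_le_four (bd j) (be 0))
    have h2 := abs_le.1 (abs_mul_le_four (be j) (bd 0))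
    rw [abs_le]
    constructor <;> linarith
  by_cases h1 : ∃ d ∈ H, (∀ i, |d i| ≤ 2) ∧ d 1 ≠ 0
  · obtain ⟨d, hd, bd, h⟩ := h1
    by_cases he : ∃ e ∈ H, (∀ i, |e i| ≤ 2) ∧ d 1 * e 0 - e 1 * d 0 ≠ 0
    · right
      obtain ⟨e, he, be, h'⟩ := he
      refine two d hd e he bd be 1 h' ?_
      have := h2 d hd e he bd be
      convert H.sub_mem (H.zsmul_mem he (d 1)) (H.zsmul_mem hd (e 1)) using 1
      ext i; fin_cases i <;> simp <;> linarith
    · left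
      push Not at he
      refine ⟨![d 1, -d 0, 0], h, fun e he' be => ?_⟩
      have := he e he' be
      simp
      linarith
  by_cases h1' : ∃ d ∈ H, (∀ i, |d i| ≤ 2) ∧ d 2 ≠ 0
  · obtain ⟨d, hd, bd, h⟩ := h1'
    by_cases he : ∃ e ∈ H, (∀ i, |e i| ≤ 2) ∧ d 2 * e 0 - e 2 * d 0 ≠ 0
    · right
      obtain ⟨e, he, be, h'⟩ := he
      refine two d hd e he bd be 2 h' ?_
      have := h2 d hd e he bd be
      convert H.sub_mem (H.zsmul_mem he (d 2)) (H.zsmul_mem hd (e 2)) using 1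
      ext i; fin_cases i <;> simp <;> linarith
    · left
      push Not at he
      refine ⟨![d 2, 0, -d 0], h, fun e he' be => ?_⟩
      have := he e he' be
      simp
      linarith
  push Not at h1 h1'
  by_cases h0 : ∃ d ∈ H, (∀ i, |d i| ≤ 2) ∧ d 0 ≠ 0
  · right
    obtain ⟨d, hd, bd, h⟩ := h0
    refine fin (d 0) h ((bd 0).trans (by norm_num)) ?_
    convert hd using 1
    ext i; fin_cases i <;> simp [h1 d hd bd, h1' d hd bd]
  · left
    push Not at h0
    refine ⟨![1, 0, 0], by simp, fun e he be => ?_⟩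
    simp [h0 e he be]

/-- A polynomial relation of degree at most `2` in each variable between three roots of unity
either bounds the order of the first one, or holds along a one-parameter family in which the
first variable is not constant. -/
theorem exists_pow_eq_one_or_family (P : MvPolynomial (Fin 3) ℚ) (hP : ∀ i, P.degreeOf i ≤ 2)
    (x : Fin 3 → ℂ) (hx : ∀ i, RationalAngles.IsRootOfUnity (x i)) (h : P.aeval x = 0) :
    (∃ m : ℕ, 0 < m ∧ m ≤ 48 * primorial 27 ∧ x 0 ^ m = 1) ∨
    ∃ α : Fin 3 → ℤ, α 0 ≠ 0 ∧ ∀ t : ℂ, t ≠ 0 → P.aeval (fun i => x i * t ^ α i) = 0 := by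
  classical
  set M := primorial 27 with hM
  have hMpos : 0 < M := primorial_pos 27
  choose N hN hxN using hx
  have hx0 : ∀ i, x i ≠ 0 := by
    intro i h0
    have := hxN i
    rw [h0, zero_pow (hN i).ne'] at this
    exact zero_ne_one this
  have hev : ∀ y : Fin 3 → ℂ, P.aeval y = ∑ e ∈ P.support, ((P.coeff e : ℚ) : ℂ) * ∏ i, y i ^ e i := by
    intro y
    rw [MvPolynomial.aeval_def, MvPolynomial.eval₂_eq']
    rfl
  set ζ : (Fin 3 →₀ ℕ) → ℂ := fun e => ∏ i, x i ^ e i with hζ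
  have hle : ∀ e ∈ P.support, ∀ i, e i ≤ 2 := fun e he i =>
    (MvPolynomial.degreeOf_le_iff.1 (hP i)) e he
  -- Each of the three exponents lies in `{0, 1, 2}`.
  have hcard : P.support.card ≤ 27 := by
    have : P.support.card ≤ (Finset.univ : Finset (Fin 3 → Fin 3)).card := by
      apply Finset.card_le_card_of_injOn (fun e i => (Fin.ofNat 3 (e i))) (fun _ _ => by simp)
      intro e he f hf hef
      ext i
      have h1 := congrFun hef i
      have h2 := hle e he i
      have h3 := hle f hf i
      simp only [Fin.ofNat_eq_cast, Fin.ext_iff, Fin.val_natCast] at h1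
      omega
    simpa using this
  have hclass := sum_filter_pow_primorial_eq_zero 27 (∏ i, N i)
    (Finset.prod_pos fun i _ => hN i) P.support (fun e => P.coeff e) ζ hcard
    (by
      intro e _
      rw [hζ, ← Finset.prod_pow]
      apply Finset.prod_eq_one
      intro i _
      obtain ⟨k, hk⟩ := Finset.dvd_prod_of_mem N (Finset.mem_univ i)
      rw [hk, pow_right_comm, pow_mul, hxN, one_pow, one_pow])
    (by rw [← h, hev])
  -- Differences of exponents of monomials in the same vanishing subsum lie in `H` and have entries
  -- of absolute value at most 2. A form `α` killing them makes `t ^ (α · e)` constant on each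
  -- subsum, so each subsum still vanishes after the deformation.
  let H : AddSubgroup (Fin 3 → ℤ) :=
    { carrier := {d | (∏ i, x i ^ d i) ^ M = 1}
      zero_mem' := by simp
      add_mem' := by
        intro a b ha hb
        simp only [Set.mem_ofPred_eq, Pi.add_apply] at *
        rw [Finset.prod_congr rfl fun i _ => zpow_add₀ (hx0 i) (a i) (b i),
          Finset.prod_mul_distrib, mul_pow, ha, hb, one_mul]
      neg_mem' := by
        intro a ha
        simp only [Set.mem_ofPred_eq, Pi.neg_apply] at *
        simp_rw [zpow_neg, Finset.prod_inv_distrib, inv_pow, ha, inv_one] }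
  have hmem : ∀ d, d ∈ H ↔ (∏ i, x i ^ d i) ^ M = 1 := fun d => Iff.rfl
  rcases exists_linear_form_or_mem_single H with ⟨α, hα, horth⟩ | ⟨m, hm, hm', hmH⟩
  · right
    refine ⟨α, hα, fun t ht => ?_⟩
    rw [hev, ← Finset.sum_fiberwise_of_maps_to (t := P.support.image fun e => ζ e ^ M)
      (g := fun e => ζ e ^ M) (fun e he => Finset.mem_image_of_mem _ he)]
    apply Finset.sum_eq_zero
    intro z hz
    obtain ⟨e₀, he₀, rfl⟩ := Finset.mem_image.1 hz
    have hterm : ∀ e, ∏ i, (x i * t ^ α i) ^ e i =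
        ζ e * t ^ (α 0 * e 0 + α 1 * e 1 + α 2 * e 2) := by
      intro e
      rw [hζ]
      simp only [Fin.prod_univ_three, mul_pow, zpow_add₀ ht, zpow_mul, zpow_natCast]
      ring
    have hζ0 : ∀ e, ζ e ≠ 0 := fun e => Finset.prod_ne_zero_iff.2 fun i _ => pow_ne_zero _ (hx0 i)
    have := hclass (ζ e₀ ^ M)
    calc _ = t ^ (α 0 * e₀ 0 + α 1 * e₀ 1 + α 2 * e₀ 2) *
          ∑ e ∈ P.support with ζ e ^ M = ζ e₀ ^ M, ((P.coeff e : ℚ) : ℂ) * ζ e := by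
          rw [Finset.mul_sum]
          apply Finset.sum_congr rfl
          intro e he
          rw [Finset.mem_filter] at he
          have hH : (fun i => (e i : ℤ) - e₀ i) ∈ H := by
            rw [hmem]
            simp_rw [zpow_sub₀ (hx0 _), Finset.prod_div_distrib, zpow_natCast, div_pow]
            rw [div_eq_one_iff_eq (pow_ne_zero _ (hζ0 e₀))]
            exact he.2
          have h1 := horth _ hH (by
            intro i
            have h1 := hle e he.1 i
            have h2 := hle e₀ he₀ i
            rw [abs_le]
            constructor <;> omega)
          have h2 : α 0 * e 0 + α 1 * e 1 + α 2 * e 2 =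
              α 0 * e₀ 0 + α 1 * e₀ 1 + α 2 * e₀ 2 := by linear_combination h1
          rw [hterm, h2]
          ring
      _ = 0 := by rw [this, mul_zero]
  · left
    refine ⟨m * M, by positivity, Nat.mul_le_mul_right M hm', ?_⟩
    rw [hmem] at hmH
    simpa [Fin.prod_univ_three, pow_mul] using hmH

/-! ### Deformations of the relation between four lines -/

/-- The coefficients of a vanishing Laurent polynomial function vanish. -/
theorem sum_filter_eq_zero_of_laurent {ι : Type*} (S : Finset ι) (c : ι → ℂ) (k : ι → ℤ)
    (h : ∀ t : ℂ, t ≠ 0 → ∑ i ∈ S, c i * t ^ k i = 0) (n : ℤ) :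
    ∑ i ∈ S with k i = n, c i = 0 := by
  obtain ⟨N, hN⟩ : ∃ N : ℕ, ∀ i ∈ S, 0 ≤ k i + N := by
    refine ⟨∑ i ∈ S, (k i).natAbs, fun i hi => ?_⟩
    have := Finset.single_le_sum (f := fun i => (k i).natAbs) (fun _ _ => Nat.zero_le _) hi
    omega
  by_cases hn : 0 ≤ n + N
  · set f : Polynomial ℂ := ∑ i ∈ S, Polynomial.C (c i) * Polynomial.X ^ (k i + N).toNat with hf
    -- The factor `X` disposes of `t = 0`, where the hypothesis says nothing.
    have hX : Polynomial.X * f = 0 := by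
      apply Polynomial.funext
      intro t
      by_cases ht : t = 0
      · simp [ht]
      · rw [Polynomial.eval_mul, hf, Polynomial.eval_finsetSum]
        have : ∑ i ∈ S, Polynomial.eval t (Polynomial.C (c i) * Polynomial.X ^ (k i + N).toNat) =
            t ^ N * ∑ i ∈ S, c i * t ^ k i := by
          rw [Finset.mul_sum]
          apply Finset.sum_congr rfl
          intro i hi
          simp only [Polynomial.eval_mul, Polynomial.eval_C, Polynomial.eval_pow, Polynomial.eval_X]
          rw [← zpow_natCast, Int.toNat_of_nonneg (hN i hi), zpow_add₀ ht, zpow_natCast]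
          ring
        rw [this, h t ht]
        simp
    have hf0 : f = 0 := (mul_eq_zero.1 hX).resolve_left Polynomial.X_ne_zero
    have := congrArg (fun g => Polynomial.coeff g (n + N).toNat) hf0
    simp only [hf, Polynomial.finsetSum_coeff, Polynomial.coeff_C_mul, Polynomial.coeff_X_pow,
      Polynomial.coeff_zero] at this
    rw [← this, Finset.sum_filter]
    apply Finset.sum_congr rfl
    intro i hi
    have := hN i hi
    by_cases hk : k i = n
    · rw [if_pos hk, if_pos (by rw [hk]), mul_one]
    · rw [if_neg hk, if_neg (by omega), mul_zero]
  · apply Finset.sum_eq_zero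
    intro i hi
    rw [Finset.mem_filter] at hi
    have := hN i hi.1
    omega

/-- The determinant of the `4 × 4` matrix with rows `(pⱼ, qⱼ, Yⱼ pⱼ, Yⱼ qⱼ)`. -/
noncomputable def quadDet (p q : Fin 4 → ℚ) (Y : Fin 4 → ℂ) : ℂ :=
  (p 0 * q 1 - q 0 * p 1) * (p 2 * q 3 - q 2 * p 3) * (Y 0 * Y 1 + Y 2 * Y 3)
    - (p 0 * q 2 - q 0 * p 2) * (p 1 * q 3 - q 1 * p 3) * (Y 0 * Y 2 + Y 1 * Y 3)
    + (p 0 * q 3 - q 0 * p 3) * (p 1 * q 2 - q 1 * p 2) * (Y 0 * Y 3 + Y 1 * Y 2)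

/-- Some nonzero quadruple `(T, W, S, R)` satisfies `pⱼ T + qⱼ W = Yⱼ (pⱼ S + qⱼ R)` for all `j`. -/
def HasCommonSolution {n : ℕ} (p q : Fin n → ℚ) (Y : Fin n → ℂ) : Prop :=
  ∃ T W S R : ℂ, ¬ (T = 0 ∧ W = 0 ∧ S = 0 ∧ R = 0) ∧
    ∀ j, p j * T + q j * W = Y j * (p j * S + q j * R)

/-- The equations say that the matrix kills `(T, W, -S, -R)`, and `quadDet` is the Laplace expansion
of its determinant. -/
theorem hasCommonSolution_iff_quadDet (p q : Fin 4 → ℚ) (Y : Fin 4 → ℂ) :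
    HasCommonSolution p q Y ↔ quadDet p q Y = 0 := by
  have hdet : quadDet p q Y =
      (Matrix.of fun j => ![(p j : ℂ), q j, Y j * p j, Y j * q j]).det := by
    simp [Matrix.det_succ_row_zero, Fin.sum_univ_succ, Fin.succAbove, quadDet]
    ring
  rw [hdet, ← Matrix.exists_mulVec_eq_zero_iff]
  constructor
  · rintro ⟨T, W, S, R, h0, h⟩
    refine ⟨![T, W, -S, -R], fun h1 => h0 ?_, ?_⟩
    · exact ⟨by simpa using congrFun h1 0, by simpa using congrFun h1 1,
        by simpa using congrFun h1 2, by simpa using congrFun h1 3⟩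
    · ext j
      simp [Matrix.mulVec, dotProduct, Fin.sum_univ_four]
      linear_combination h j
  · rintro ⟨v, hv, h⟩
    refine ⟨v 0, v 1, -v 2, -v 3, fun h0 => hv ?_, fun j => ?_⟩
    · ext i
      fin_cases i <;> simp_all
    · have := congrFun h j
      simp [Matrix.mulVec, dotProduct, Fin.sum_univ_four] at this
      linear_combination this

theorem HasCommonSolution.comp {n m : ℕ} {p q : Fin n → ℚ} {Y : Fin n → ℂ}
    (h : HasCommonSolution p q Y) (σ : Fin m → Fin n) :
    HasCommonSolution (p ∘ σ) (q ∘ σ) (Y ∘ σ) := by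
  obtain ⟨T, W, S, R, h0, h⟩ := h
  exact ⟨T, W, S, R, h0, fun j => h (σ j)⟩

/-- No exponent may be attained by a single nonzero term. With `k` increasing, `k 0 + k 1` is the
lowest and `k 2 + k 3` the highest, and comparing the coefficients there restricts the ties. -/
theorem exponents_of_six_term_relation {b₁ b₂ b₃ : ℂ} (h₁ : b₁ ≠ 0) (h₂ : b₂ ≠ 0) (h₃ : b₃ ≠ 0)
    (hb : b₁ + b₂ + b₃ = 0) {y : Fin 4 → ℂ} (hy : ∀ i, y i ≠ 0) (hyi : Function.Injective y)
    {k : Fin 4 → ℤ} (hk : Monotone k)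
    (h : ∀ t : ℂ, t ≠ 0 →
      b₁ * ((y 0 * t ^ k 0) * (y 1 * t ^ k 1) + (y 2 * t ^ k 2) * (y 3 * t ^ k 3)) +
      b₂ * ((y 0 * t ^ k 0) * (y 2 * t ^ k 2) + (y 1 * t ^ k 1) * (y 3 * t ^ k 3)) +
      b₃ * ((y 0 * t ^ k 0) * (y 3 * t ^ k 3) + (y 1 * t ^ k 1) * (y 2 * t ^ k 2)) = 0) :
    k 1 = k 2 ∧ k 0 + k 3 = 2 * k 1 ∧ (k 0 ≠ k 3 → y 1 = - y 2) := by
  have k01 : k 0 ≤ k 1 := hk (by decide)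
  have k12 : k 1 ≤ k 2 := hk (by decide)
  have k23 : k 2 ≤ k 3 := hk (by decide)
  have L : ∀ n, (if k 0 + k 1 = n then b₁ * (y 0 * y 1) else 0) +
      (if k 2 + k 3 = n then b₁ * (y 2 * y 3) else 0) +
      (if k 0 + k 2 = n then b₂ * (y 0 * y 2) else 0) +
      (if k 1 + k 3 = n then b₂ * (y 1 * y 3) else 0) +
      (if k 0 + k 3 = n then b₃ * (y 0 * y 3) else 0) +
      (if k 1 + k 2 = n then b₃ * (y 1 * y 2) else 0) = 0 := by
    intro n
    have := sum_filter_eq_zero_of_laurent Finset.univ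
      ![b₁ * (y 0 * y 1), b₁ * (y 2 * y 3), b₂ * (y 0 * y 2), b₂ * (y 1 * y 3), b₃ * (y 0 * y 3),
        b₃ * (y 1 * y 2)]
      ![k 0 + k 1, k 2 + k 3, k 0 + k 2, k 1 + k 3, k 0 + k 3, k 1 + k 2] (by
        intro t ht
        rw [← h t ht]
        simp [Fin.sum_univ_succ, zpow_add₀ ht]
        ring) n
    rwa [Finset.sum_filter, Fin.sum_univ_six] at this
  have y01 : y 0 - y 1 ≠ 0 := sub_ne_zero.2 (hyi.ne (by decide))
  have y12 : y 1 - y 2 ≠ 0 := sub_ne_zero.2 (hyi.ne (by decide))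
  have y23 : y 2 - y 3 ≠ 0 := sub_ne_zero.2 (hyi.ne (by decide))
  have e12 : k 1 = k 2 := by
    by_contra hne
    have := L (k 0 + k 1)
    rw [if_pos rfl, if_neg (by omega), if_neg (by omega), if_neg (by omega), if_neg (by omega),
      if_neg (by omega)] at this
    simp [h₁, hy] at this
  by_cases e03 : k 0 = k 3
  · exact ⟨e12, by omega, fun h => absurd e03 h⟩
  have lo := L (k 0 + k 1)
  have hi := L (k 2 + k 3)
  -- With three equal exponents, the two coefficients and `hb` factor so as to force two of the `y
  -- i` to coincide; the same happens below when `k 2 = k 3`.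
  by_cases e01 : k 0 = k 1
  · exfalso
    rw [if_pos rfl, if_neg (by omega), if_pos (by omega), if_neg (by omega), if_neg (by omega),
      if_pos (by omega)] at lo
    rw [if_neg (by omega), if_pos rfl, if_neg (by omega), if_pos (by omega), if_pos (by omega),
      if_neg (by omega)] at hi
    have hi' : b₁ * y 2 + b₂ * y 1 + b₃ * y 0 = 0 :=
      (mul_eq_zero.1 (show y 3 * (b₁ * y 2 + b₂ * y 1 + b₃ * y 0) = 0 by
        linear_combination hi)).resolve_left (hy 3)
    have : b₂ * (y 1 - y 0) * (y 1 - y 2) = 0 := by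
      linear_combination lo + y 1 * hi' - (y 1 * y 2 + y 0 * y 1) * hb
    simp only [mul_eq_zero] at this
    rcases this with (h | h) | h
    · exact h₂ h
    · exact y01 (by linear_combination -h)
    · exact y12 h
  by_cases e23 : k 2 = k 3
  · exfalso
    rw [if_pos rfl, if_neg (by omega), if_pos (by omega), if_neg (by omega), if_pos (by omega),
      if_neg (by omega)] at lo
    rw [if_neg (by omega), if_pos rfl, if_neg (by omega), if_pos (by omega), if_neg (by omega),
      if_pos (by omega)] at hi
    have lo' : b₁ * y 1 + b₂ * y 2 + b₃ * y 3 = 0 :=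
      (mul_eq_zero.1 (show y 0 * (b₁ * y 1 + b₂ * y 2 + b₃ * y 3) = 0 by
        linear_combination lo)).resolve_left (hy 0)
    have : b₂ * (y 2 - y 3) * (y 2 - y 1) = 0 := by
      linear_combination hi + y 2 * lo' - (y 1 * y 2 + y 2 * y 3) * hb
    simp only [mul_eq_zero] at this
    rcases this with (h | h) | h
    · exact h₂ h
    · exact y23 h
    · exact y12 (by linear_combination -h)
  -- Now `k 0 < k 1 = k 2 < k 3`. The extreme coefficients give `y 1 = -y 2`, and the two terms with
  -- `b₃` must share their exponent, since neither can cancel alone.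
  have mid := L (k 1 + k 2)
  rw [if_pos rfl, if_neg (by omega), if_pos (by omega), if_neg (by omega), if_neg (by omega),
      if_neg (by omega)] at lo
  rw [if_neg (by omega), if_pos rfl, if_neg (by omega), if_pos (by omega), if_neg (by omega),
      if_neg (by omega)] at hi
  have lo' : b₁ * y 1 + b₂ * y 2 = 0 :=
    (mul_eq_zero.1 (show y 0 * (b₁ * y 1 + b₂ * y 2) = 0 by
      linear_combination lo)).resolve_left (hy 0)
  have hi' : b₁ * y 2 + b₂ * y 1 = 0 :=
    (mul_eq_zero.1 (show y 3 * (b₁ * y 2 + b₂ * y 1) = 0 by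
      linear_combination hi)).resolve_left (hy 3)
  have hsum : y 1 + y 2 = 0 := by
    have : b₁ * (y 1 - y 2) * (y 1 + y 2) = 0 := by
      linear_combination y 1 * lo' - y 2 * hi'
    simp only [mul_eq_zero] at this
    rcases this with (h | h) | h
    · exact absurd h h₁
    · exact absurd h y12
    · exact h
  rw [if_neg (by omega), if_neg (by omega), if_neg (by omega), if_neg (by omega),
      if_pos (rfl : k 1 + k 2 = k 1 + k 2)] at mid
  by_cases e : k 0 + k 3 = k 1 + k 2
  · exact ⟨e12, by omega, fun _ => by linear_combination hsum⟩
  · rw [if_neg e] at mid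
    simp [h₃, hy] at mid

theorem exponents_of_four_lines {p q : Fin 4 → ℚ} (hpq : ∀ i j, i ≠ j → p i * q j - q i * p j ≠ 0)
    {y : Fin 4 → ℂ} (hy : ∀ i, y i ≠ 0) (hyi : Function.Injective y)
    {k : Fin 4 → ℤ} (hk : Monotone k)
    (h : ∀ t : ℂ, t ≠ 0 → HasCommonSolution p q fun j => y j * t ^ k j) :
    k 1 = k 2 ∧ k 0 + k 3 = 2 * k 1 ∧ (k 0 ≠ k 3 → y 1 = - y 2) := by
  have hb : ∀ i j, i ≠ j → (p i * q j - q i * p j : ℂ) ≠ 0 := fun i j hij => by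
    exact_mod_cast hpq i j hij
  -- The coefficients sum to zero by the Plücker relation between the `2 × 2` minors.
  refine exponents_of_six_term_relation
    (mul_ne_zero (hb 0 1 (by decide)) (hb 2 3 (by decide)))
    (neg_ne_zero.2 (mul_ne_zero (hb 0 2 (by decide)) (hb 1 3 (by decide))))
    (mul_ne_zero (hb 0 3 (by decide)) (hb 1 2 (by decide))) (by ring) hy hyi hk ?_
  intro t ht
  rw [← (hasCommonSolution_iff_quadDet _ _ _).1 (h t ht), quadDet]
  ring

/-- In any four of the sorted exponents the middle two agree and are the mean of the outer two;
overlapping quadruples leave no room for variation. -/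
theorem exponents_of_five_lines {p q : Fin 5 → ℚ} (hpq : ∀ i j, i ≠ j → p i * q j - q i * p j ≠ 0)
    {y : Fin 5 → ℂ} (hy : ∀ i, y i ≠ 0) (hyi : Function.Injective y) {k : Fin 5 → ℤ}
    (h : ∀ t : ℂ, t ≠ 0 → HasCommonSolution p q fun j => y j * t ^ k j) (i j : Fin 5) :
    k i = k j := by
  set σ := Tuple.sort k
  have hm : Monotone (k ∘ σ) := Tuple.monotone_sort k
  have key : ∀ f : Fin 4 → Fin 5, StrictMono f → (k ∘ σ) (f 1) = (k ∘ σ) (f 2) ∧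
      (k ∘ σ) (f 0) + (k ∘ σ) (f 3) = 2 * (k ∘ σ) (f 1) := by
    intro f hf
    have hinj : Function.Injective (σ ∘ f) := σ.injective.comp hf.injective
    have := exponents_of_four_lines (p := p ∘ σ ∘ f) (q := q ∘ σ ∘ f) (y := y ∘ σ ∘ f)
      (k := k ∘ σ ∘ f) (fun i j hij => hpq _ _ (hinj.ne hij)) (fun i => hy _) (hyi.comp hinj)
      (hm.comp hf.monotone) (fun t ht => (h t ht).comp (σ ∘ f))
    exact ⟨this.1, this.2.1⟩
  have h1 := key ![0, 1, 2, 3] (by decide)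
  have h2 := key ![1, 2, 3, 4] (by decide)
  have h3 := key ![0, 1, 2, 4] (by decide)
  simp only [Matrix.cons_val] at h1 h2 h3
  have all : ∀ i, (k ∘ σ) i = (k ∘ σ) 1 := by
    intro i
    fin_cases i
    · show (k ∘ σ) 0 = _
      omega
    · rfl
    · show (k ∘ σ) 2 = _
      omega
    · show (k ∘ σ) 3 = _
      omega
    · show (k ∘ σ) 4 = _
      omega
  have hi := all (σ.symm i)
  have hj := all (σ.symm j)
  simp only [Function.comp_apply, Equiv.apply_symm_apply] at hi hj
  rw [hi, hj]

/-! ### Deformations of a linear relation between cotangents -/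

/-- The numerator of `∑ⱼ βⱼ (1 + Xⱼ) / (1 - Xⱼ)`. -/
noncomputable def cotNum (β X : Fin 3 → ℂ) : ℂ :=
  β 0 * (1 + X 0) * ((1 - X 1) * (1 - X 2)) + β 1 * (1 + X 1) * ((1 - X 0) * (1 - X 2)) +
    β 2 * (1 + X 2) * ((1 - X 0) * (1 - X 1))

/-- The constant term `β 0 + β 1 + β 2` must be cancelled by another term of exponent zero, so `α 0
= 0`. If `α 1 > 0`, the coefficients at the lowest and highest exponents give `x 0 ^ 2 = 1`. -/
theorem cot_family_of_monotone {β x : Fin 3 → ℂ} (hs : β 0 + β 1 + β 2 ≠ 0) (hβ : ∀ j, β j ≠ 0)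
    (hx0 : ∀ j, x j ≠ 0) (hx : ∀ j, x j ≠ 1) {α : Fin 3 → ℤ} (hα : Monotone α) (h0 : 0 ≤ α 0)
    (h2 : α 2 ≠ 0) (h : ∀ t : ℂ, t ≠ 0 → cotNum β (fun j => x j * t ^ α j) = 0) :
    x 0 = -1 ∧ β 1 = - β 2 := by
  have a01 : α 0 ≤ α 1 := hα (by decide)
  have a12 : α 1 ≤ α 2 := hα (by decide)
  have L : ∀ n, (if 0 = n then β 0 + β 1 + β 2 else 0) +
      (if α 0 = n then (β 0 - β 1 - β 2) * x 0 else 0) +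
      (if α 1 = n then (β 1 - β 0 - β 2) * x 1 else 0) +
      (if α 2 = n then (β 2 - β 0 - β 1) * x 2 else 0) +
      (if α 1 + α 2 = n then (β 0 - β 1 - β 2) * (x 1 * x 2) else 0) +
      (if α 0 + α 2 = n then (β 1 - β 0 - β 2) * (x 0 * x 2) else 0) +
      (if α 0 + α 1 = n then (β 2 - β 0 - β 1) * (x 0 * x 1) else 0) +
      (if α 0 + α 1 + α 2 = n then (β 0 + β 1 + β 2) * (x 0 * x 1 * x 2) else 0) = 0 := by
    intro n
    have := sum_filter_eq_zero_of_laurent Finset.univ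
      ![β 0 + β 1 + β 2, (β 0 - β 1 - β 2) * x 0, (β 1 - β 0 - β 2) * x 1,
        (β 2 - β 0 - β 1) * x 2, (β 0 - β 1 - β 2) * (x 1 * x 2), (β 1 - β 0 - β 2) * (x 0 * x 2),
        (β 2 - β 0 - β 1) * (x 0 * x 1), (β 0 + β 1 + β 2) * (x 0 * x 1 * x 2)]
      ![0, α 0, α 1, α 2, α 1 + α 2, α 0 + α 2, α 0 + α 1, α 0 + α 1 + α 2] (by
        intro t ht
        rw [← h t ht]
        simp [Fin.sum_univ_succ, zpow_add₀ ht, cotNum]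
        ring) n
    rwa [Finset.sum_filter, Fin.sum_univ_eight] at this
  have l0 := L 0
  have e0 : α 0 = 0 := by
    by_contra hne
    rw [if_pos rfl, if_neg (by omega), if_neg (by omega), if_neg (by omega), if_neg (by omega),
      if_neg (by omega), if_neg (by omega), if_neg (by omega)] at l0
    exact hs (by linear_combination l0)
  -- If only the third variable moves, the two coefficients combine to `2 * β 2 * x 2 * (x 0 - 1) *
  -- (x 1 - 1)`, which is nonzero.
  by_cases e1 : α 1 = 0
  · exfalso
    have l2 := L (α 2)
    rw [if_pos rfl, if_pos (by omega), if_pos (by omega), if_neg (by omega), if_neg (by omega),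
      if_neg (by omega), if_pos (by omega), if_neg (by omega)] at l0
    rw [if_neg (by omega), if_neg (by omega), if_neg (by omega), if_pos (by omega),
      if_pos (by omega), if_pos (by omega), if_neg (by omega), if_pos (by omega)] at l2
    have : (2 * β 2 * x 2) * ((x 0 - 1) * (x 1 - 1)) = 0 := by
      linear_combination x 2 * l0 + l2
    simp [hβ, hx0, sub_eq_zero, hx] at this
  have l3 := L (α 1 + α 2)
  rw [if_pos rfl, if_pos (by omega), if_neg (by omega), if_neg (by omega), if_neg (by omega),
      if_neg (by omega), if_neg (by omega), if_neg (by omega)] at l0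
  rw [if_neg (by omega), if_neg (by omega), if_neg (by omega), if_neg (by omega),
      if_pos (by omega), if_neg (by omega), if_neg (by omega), if_pos (by omega)] at l3
  have l3' : (β 0 - β 1 - β 2) + (β 0 + β 1 + β 2) * x 0 = 0 :=
    (mul_eq_zero.1 (show x 1 * x 2 * ((β 0 - β 1 - β 2) + (β 0 + β 1 + β 2) * x 0) = 0 by
      linear_combination l3)).resolve_left (mul_ne_zero (hx0 1) (hx0 2))
  have hx1 : x 0 = -1 := by
    have : (β 0 + β 1 + β 2) * ((x 0 - 1) * (x 0 + 1)) = 0 := by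
      linear_combination x 0 * l3' - l0
    simp only [mul_eq_zero] at this
    rcases this with h | h | h
    · exact absurd h hs
    · exact absurd (by linear_combination h) (hx 0)
    · linear_combination h
  refine ⟨hx1, ?_⟩
  rw [hx1] at l3'
  linear_combination -(1 / 2) * l3'

theorem cotNum_comp (β X : Fin 3 → ℂ) (σ : Equiv.Perm (Fin 3)) :
    cotNum (β ∘ σ) (X ∘ σ) = cotNum β X := by
  have : ∀ β X : Fin 3 → ℂ, cotNum β X = ∑ j, β j * (1 + X j) * ∏ i ∈ {j}ᶜ, (1 - X i) := by
    intro β X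
    have h0 : ({0}ᶜ : Finset (Fin 3)) = {1, 2} := by decide
    have h1 : ({1}ᶜ : Finset (Fin 3)) = {0, 2} := by decide
    have h2 : ({2}ᶜ : Finset (Fin 3)) = {0, 1} := by decide
    rw [Fin.sum_univ_three, h0, h1, h2]
    simp [cotNum]
  rw [this, this β X, ← Equiv.sum_comp σ fun j => β j * (1 + X j) * ∏ i ∈ {j}ᶜ, (1 - X i)]
  apply Finset.sum_congr rfl
  intro j _
  congr 1
  apply Finset.prod_nbij σ
  · intro i hi; simpa using hi
  · exact σ.injective.injOn
  · intro i hi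
    exact ⟨σ.symm i, by simpa [Equiv.symm_apply_eq] using hi, by simp⟩
  · intro i _; rfl

/-- Replacing `X` by `X⁻¹` negates `(1 + X) / (1 - X)`, so changing signs of the `β j` makes all
exponents nonnegative; a permutation then sorts them. This is why every signed sum of the `β j` has
to be nonzero. -/
theorem cot_family {β x : Fin 3 → ℂ} (hs : ∀ ε : Fin 3 → ℤˣ, ∑ j, (ε j : ℂ) * β j ≠ 0)
    (hβ : ∀ j, β j ≠ 0) (hx0 : ∀ j, x j ≠ 0) (hx : ∀ j, x j ≠ 1) {α : Fin 3 → ℤ}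
    (hα : α ≠ 0) (h : ∀ t : ℂ, t ≠ 0 → cotNum β (fun j => x j * t ^ α j) = 0) :
    ∃ σ : Equiv.Perm (Fin 3), x (σ 0) = -1 ∧
      (β (σ 1) = β (σ 2) ∨ β (σ 1) = - β (σ 2)) := by
  obtain ⟨ε, hε⟩ : ∃ ε : Fin 3 → ℤˣ, ∀ j, 0 ≤ (ε j : ℤ) * α j := by
    refine ⟨fun j => if 0 ≤ α j then 1 else -1, fun j => ?_⟩
    dsimp only
    split_ifs with hj
    · simpa using hj
    · simp; omega
  have hflip : ∀ t : ℂ, t ≠ 0 →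
      cotNum (fun j => (ε j : ℂ) * β j) (fun j => x j ^ (ε j : ℤ) * t ^ ((ε j : ℤ) * α j)) = 0 := by
    intro t ht
    have hX : ∀ j, x j ^ (ε j : ℤ) * t ^ ((ε j : ℤ) * α j) = (x j * t ^ α j) ^ (ε j : ℤ) := by
      intro j
      rw [mul_zpow, ← zpow_mul, mul_comm (α j)]
    simp_rw [hX]
    have hne : ∀ j, x j * t ^ α j ≠ 0 := fun j => mul_ne_zero (hx0 j) (zpow_ne_zero _ ht)
    have := h t ht
    simp only [cotNum] at this ⊢
    have hs : ∀ j, ∃ s : ℂ, (ε j : ℂ) * (1 + (x j * t ^ α j) ^ (ε j : ℤ)) = s * (1 + x j * t ^ α j) ∧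
        1 - (x j * t ^ α j) ^ (ε j : ℤ) = s * (1 - x j * t ^ α j) := by
      intro j
      have := hne j
      generalize x j * t ^ α j = X at *
      rcases Int.units_eq_one_or (ε j) with h | h
      · exact ⟨1, by simp [h], by simp [h]⟩
      · refine ⟨-X⁻¹, ?_, ?_⟩ <;> simp [h] <;> field_simp <;> ring
    choose s hs₁ hs₂ using hs
    rw [hs₂, hs₂, hs₂]
    linear_combination (s 0 * s 1 * s 2) * this +
      β 0 * (s 1 * s 2 * ((1 - x 1 * t ^ α 1) * (1 - x 2 * t ^ α 2))) * hs₁ 0 +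
      β 1 * (s 0 * s 2 * ((1 - x 0 * t ^ α 0) * (1 - x 2 * t ^ α 2))) * hs₁ 1 +
      β 2 * (s 0 * s 1 * ((1 - x 0 * t ^ α 0) * (1 - x 1 * t ^ α 1))) * hs₁ 2
  set γ : Fin 3 → ℤ := fun j => (ε j : ℤ) * α j with hγ
  set σ := Tuple.sort γ
  have hm : Monotone (γ ∘ σ) := Tuple.monotone_sort γ
  have hz : ∀ j, x j ^ (ε j : ℤ) = x j ∨ x j ^ (ε j : ℤ) = (x j)⁻¹ := by
    intro j
    rcases Int.units_eq_one_or (ε j) with h | h <;> simp [h]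
  have hu : ∀ j, ((ε j : ℤ) : ℂ) = 1 ∨ ((ε j : ℤ) : ℂ) = -1 := by
    intro j
    rcases Int.units_eq_one_or (ε j) with h | h <;> simp [h]
  have := cot_family_of_monotone (β := (fun j => (ε j : ℂ) * β j) ∘ σ)
    (x := (fun j => x j ^ (ε j : ℤ)) ∘ σ) (α := γ ∘ σ)
    (by
      have := hs ε
      rw [← Equiv.sum_comp σ, Fin.sum_univ_three] at this
      exact this)
    (fun j => mul_ne_zero (by rcases hu (σ j) with h | h <;> simp [h]) (hβ _))
    (fun j => zpow_ne_zero _ (hx0 _))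
    (fun j => by rcases hz (σ j) with h | h <;> simp [h, hx])
    hm (hε _)
    (by
      intro h2
      apply hα
      ext j
      have h1 : γ j ≤ 0 := by
        have := hm (Fin.le_last (σ.symm j))
        simp only [Function.comp_apply, Equiv.apply_symm_apply] at this
        exact this.trans h2.le
      have h3 : γ j = 0 := le_antisymm h1 (hε j)
      simpa [hγ] using h3)
    (fun t ht => by
      have := hflip t ht
      rw [← cotNum_comp _ _ σ] at this
      exact this)
  refine ⟨σ, ?_, ?_⟩
  · have h1 := this.1
    simp only [Function.comp_apply] at h1
    rcases hz (σ 0) with h | h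
    · rwa [h] at h1
    · rw [h, inv_eq_iff_eq_inv] at h1
      rw [h1]; norm_num
  · have h1 := this.2
    simp only [Function.comp_apply] at h1
    rcases hu (σ 1) with h | h <;> rcases hu (σ 2) with h' | h' <;> rw [h, h'] at h1
    · right; linear_combination h1
    · left; linear_combination h1
    · left; linear_combination -h1
    · right; linear_combination -h1

/-! ### Polynomial families of solutions -/

/-- The form `∑ⱼ βⱼ Aⱼ ∏_{i ≠ j} Bᵢ`. -/
def cotForm {R : Type*} [CommRing R] (β A B : Fin 3 → R) : R :=
  β 0 * A 0 * (B 1 * B 2) + β 1 * A 1 * (B 0 * B 2) + β 2 * A 2 * (B 0 * B 1)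

open Polynomial in
-- The two cofactors multiply to a power of the prime `X`, so each is a constant times a power of
-- `X`.
theorem exists_monomial_quotient {F G : ℂ[X]} (hF : F ≠ 0) {n m : ℕ} (h₁ : F ∣ X ^ n * G)
    (h₂ : G ∣ X ^ m * F) :
    ∃ c : ℂ, c ≠ 0 ∧ ∃ k : ℤ, ∀ t : ℂ, t ≠ 0 → F.eval t = c * t ^ k * G.eval t := by
  obtain ⟨A, hA⟩ := h₁
  obtain ⟨B, hB⟩ := h₂
  have hAB : A * B = X ^ (n + m) := by
    apply mul_left_cancel₀ hF
    calc F * (A * B) = X ^ n * G * B := by rw [hA]; ring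
      _ = X ^ n * (X ^ m * F) := by rw [hB]; ring
      _ = F * X ^ (n + m) := by ring
  obtain ⟨i, -, u, hu⟩ := (dvd_prime_pow prime_X (n + m)).1 ⟨B, hAB.symm⟩
  obtain ⟨c, hc, hcu⟩ := Polynomial.isUnit_iff.1 u.isUnit
  have hc0 : c ≠ 0 := hc.ne_zero
  refine ⟨c, hc0, n - i, fun t ht => ?_⟩
  have h1 := congrArg (eval t) hA
  have h2 := congrArg (eval t) hu
  rw [← hcu] at h2
  simp only [eval_mul, eval_pow, eval_X, eval_C] at h1 h2
  rw [zpow_sub₀ ht, zpow_natCast, zpow_natCast]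
  field_simp
  rw [← h2]
  linear_combination -c * h1

theorem exists_eq_mul_isCoprime {a b : Polynomial ℂ} (ha : a ≠ 0) :
    ∃ g T W, g ≠ 0 ∧ IsCoprime T W ∧ a = g * T ∧ b = g * W := by
  obtain ⟨T, hT⟩ := EuclideanDomain.gcd_dvd_left a b
  obtain ⟨W, hW⟩ := EuclideanDomain.gcd_dvd_right a b
  have hg : EuclideanDomain.gcd a b ≠ 0 := fun h => ha (EuclideanDomain.gcd_eq_zero_iff.1 h).1
  have hab := EuclideanDomain.gcd_eq_gcd_ab a b
  set g := EuclideanDomain.gcd a b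
  refine ⟨g, T, W, hg, ⟨EuclideanDomain.gcdA a b, EuclideanDomain.gcdB a b, ?_⟩, hT, hW⟩
  apply mul_left_cancel₀ hg
  linear_combination -hab - EuclideanDomain.gcdA a b * hT - EuclideanDomain.gcdB a b * hW

open Polynomial in
-- A `2 × 2` matrix of rank one is a column times a row: the quadric `mA * mE = mB * mC` is a
-- product of two projective lines, with points `(T : W) = (mA : mC)` and `(S : R) = (mA : mB)`.
theorem exists_coprime_parametrization {mA mB mC mE : ℂ[X]} (hA : mA ≠ 0)
    (h : mA * mE = mB * mC) :
    ∃ T W S R g : ℂ[X], IsCoprime T W ∧ IsCoprime S R ∧ g ≠ 0 ∧ mA * mA = g * (T * S) ∧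
      mA * mB = g * (T * R) ∧ mA * mC = g * (W * S) ∧ mA * mE = g * (W * R) := by
  obtain ⟨g, T, W, hg, hTW, hT, hW⟩ := exists_eq_mul_isCoprime (b := mC) hA
  obtain ⟨g', S, R, hg', hSR, hS, hR⟩ := exists_eq_mul_isCoprime (b := mB) hA
  refine ⟨T, W, S, R, g * g', hTW, hSR, mul_ne_zero hg hg', ?_, ?_, ?_, ?_⟩
  · linear_combination mA * hT + g * T * hS
  · linear_combination mB * hT + g * T * hR
  · linear_combination mA * hW + g * W * hS
  · rw [h]; linear_combination mB * hW + g * W * hR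

theorem isCoprime_linear_combination {T W : Polynomial ℂ} (h : IsCoprime T W) {p q p' q' : ℂ}
    (hd : p * q' - q * p' ≠ 0) :
    IsCoprime (Polynomial.C p * T + Polynomial.C q * W)
      (Polynomial.C p' * T + Polynomial.C q' * W) := by
  obtain ⟨a, b, hab⟩ := h
  have hC : Polynomial.C (p * q' - q * p')⁻¹ *
      (Polynomial.C p * Polynomial.C q' - Polynomial.C q * Polynomial.C p') = 1 := by
    rw [← Polynomial.C_mul, ← Polynomial.C_mul, ← Polynomial.C_sub, ← Polynomial.C_mul,
      inv_mul_cancel₀ hd, Polynomial.C_1]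
  set u := Polynomial.C (p * q' - q * p')⁻¹
  refine ⟨u * (a * Polynomial.C q' - b * Polynomial.C p'),
    u * (b * Polynomial.C p - a * Polynomial.C q), ?_⟩
  linear_combination hC + u * (Polynomial.C p * Polynomial.C q' -
    Polynomial.C q * Polynomial.C p') * hab

open Polynomial in
/-- Along a one-parameter family of solutions `(T : W)`, `(S : R)` of three angle equations, at
most four lines can occur. -/
theorem not_exists_polynomial_family {p q : Fin 3 → Fin 2 → ℚ}
    (hd : ∀ j, p j 0 * q j 1 - q j 0 * p j 1 ≠ 0)
    {x : Fin 3 → ℂ} (hx : ∀ j, x j ≠ 0) {α : Fin 3 → ℤ} (hα : α 0 ≠ 0)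
    {T₀ W₀ S₀ R₀ : ℂ} (hTS : T₀ * R₀ - W₀ * S₀ ≠ 0) (hT₀ : T₀ ≠ 0) (hS₀ : S₀ ≠ 0)
    (hF₀ : ∀ j s, (p j s * T₀ + q j s * W₀ : ℂ) ≠ 0)
    (hG₀ : ∀ j s, (p j s * S₀ + q j s * R₀ : ℂ) ≠ 0)
    {T W S R : ℂ[X]} (hTW : IsCoprime T W) (hSR : IsCoprime S R)
    (h₁ : T.eval 1 * W₀ = W.eval 1 * T₀) (h₂ : S.eval 1 * R₀ = R.eval 1 * S₀)
    (h : ∀ j, X ^ (-α j).toNat * ((C (p j 0 : ℂ) * T + C (q j 0 : ℂ) * W) *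
        (C (p j 1 : ℂ) * S + C (q j 1 : ℂ) * R)) =
      C (x j) * X ^ (α j).toNat * ((C (p j 1 : ℂ) * T + C (q j 1 : ℂ) * W) *
        (C (p j 0 : ℂ) * S + C (q j 0 : ℂ) * R)))
    (f : Fin 5 → Fin 3 × Fin 2) (hf0 : f 0 = (0, 0)) (hf1 : f 1 = (0, 1))
    (hf : ∀ i j, i ≠ j → p (f i).1 (f i).2 * q (f j).1 (f j).2 -
      q (f i).1 (f i).2 * p (f j).1 (f j).2 ≠ 0) : False := by
  set F : Fin 3 → Fin 2 → ℂ[X] := fun j s => C (p j s : ℂ) * T + C (q j s : ℂ) * W with hF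
  set G : Fin 3 → Fin 2 → ℂ[X] := fun j s => C (p j s : ℂ) * S + C (q j s : ℂ) * R with hG
  have hdC : ∀ j, (p j 0 * q j 1 - q j 0 * p j 1 : ℂ) ≠ 0 := fun j => by exact_mod_cast hd j
  obtain ⟨μ, hμ, hTμ, hWμ⟩ : ∃ μ : ℂ, μ ≠ 0 ∧ T.eval 1 = μ * T₀ ∧ W.eval 1 = μ * W₀ := by
    -- The factor is nonzero because coprime polynomials have no common zero.
    refine ⟨T.eval 1 / T₀, ?_, by field_simp, by field_simp; linear_combination -h₁⟩
    intro h0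
    have hT1 : T.eval 1 = 0 := by simpa [hT₀] using h0
    have hW1 : W.eval 1 = 0 := by
      rw [hT1, zero_mul] at h₁
      exact (mul_eq_zero.1 h₁.symm).resolve_right hT₀
    obtain ⟨a, b, hab⟩ := hTW
    have := congrArg (eval 1) hab
    simp [hT1, hW1] at this
  obtain ⟨ν, hν, hSν, hRν⟩ : ∃ ν : ℂ, ν ≠ 0 ∧ S.eval 1 = ν * S₀ ∧ R.eval 1 = ν * R₀ := by
    refine ⟨S.eval 1 / S₀, ?_, by field_simp, by field_simp; linear_combination -h₂⟩
    intro h0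
    have hT1 : S.eval 1 = 0 := by simpa [hS₀] using h0
    have hW1 : R.eval 1 = 0 := by
      rw [hT1, zero_mul] at h₂
      exact (mul_eq_zero.1 h₂.symm).resolve_right hS₀
    obtain ⟨a, b, hab⟩ := hSR
    have := congrArg (eval 1) hab
    simp [hT1, hW1] at this
  have hF1 : ∀ j s, (F j s).eval 1 = μ * (p j s * T₀ + q j s * W₀) := by
    intro j s
    simp only [hF, eval_add, eval_mul, eval_C, hTμ, hWμ]
    ring
  have hG1 : ∀ j s, (G j s).eval 1 = ν * (p j s * S₀ + q j s * R₀) := by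
    intro j s
    simp only [hG, eval_add, eval_mul, eval_C, hSν, hRν]
    ring
  have hFne : ∀ j s, F j s ≠ 0 := by
    intro j s h0
    have := hF1 j s
    rw [h0, eval_zero] at this
    exact mul_ne_zero hμ (hF₀ j s) this.symm
  have hGne : ∀ j s, G j s ≠ 0 := by
    intro j s h0
    have := hG1 j s
    rw [h0, eval_zero] at this
    exact mul_ne_zero hν (hG₀ j s) this.symm
  have hxu : ∀ j, C (x j)⁻¹ * C (x j) = 1 := fun j => by
    rw [← C_mul, inv_mul_cancel₀ (hx j), C_1]
  -- The two `F` of a pair are coprime, as are the two `G`; so the angle equation makes `F j s` and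
  -- `G j s` divide each other up to powers of `X`.
  have hmono : ∀ j s, ∃ c : ℂ, c ≠ 0 ∧ ∃ k : ℤ, ∀ t : ℂ, t ≠ 0 →
      (F j s).eval t = c * t ^ k * (G j s).eval t := by
    intro j
    have hj : X ^ (-α j).toNat * (F j 0 * G j 1) = C (x j) * X ^ (α j).toNat * (F j 1 * G j 0) :=
      h j
    have c01 : IsCoprime (F j 0) (F j 1) := isCoprime_linear_combination hTW (hdC j)
    have d01 : IsCoprime (G j 0) (G j 1) := isCoprime_linear_combination hSR (hdC j)
    clear_value F G
    have f0 : F j 0 ∣ X ^ (α j).toNat * G j 0 := by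
      apply c01.dvd_of_dvd_mul_left
      refine ⟨C (x j)⁻¹ * X ^ (-α j).toNat * G j 1, ?_⟩
      linear_combination (-C (x j)⁻¹) * hj - X ^ (α j).toNat * (F j 1 * G j 0) * hxu j
    have g0 : G j 0 ∣ X ^ (-α j).toNat * F j 0 := by
      apply d01.dvd_of_dvd_mul_left
      exact ⟨C (x j) * X ^ (α j).toNat * F j 1, by linear_combination hj⟩
    have f1 : F j 1 ∣ X ^ (-α j).toNat * G j 1 := by
      apply c01.symm.dvd_of_dvd_mul_left
      exact ⟨C (x j) * X ^ (α j).toNat * G j 0, by linear_combination hj⟩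
    have g1 : G j 1 ∣ X ^ (α j).toNat * F j 1 := by
      apply d01.symm.dvd_of_dvd_mul_left
      refine ⟨C (x j)⁻¹ * X ^ (-α j).toNat * F j 0, ?_⟩
      linear_combination (-C (x j)⁻¹) * hj - X ^ (α j).toNat * (F j 1 * G j 0) * hxu j
    exact Fin.forall_fin_two.2 ⟨exists_monomial_quotient (hFne j 0) f0 g0,
      exists_monomial_quotient (hFne j 1) f1 g1⟩
  choose c hc k hk using hmono
  have hk01 : k 0 0 = k 0 1 := by
    have := exponents_of_five_lines (p := fun i => p (f i).1 (f i).2)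
      (q := fun i => q (f i).1 (f i).2) hf (y := fun i => c (f i).1 (f i).2)
      (fun i => hc _ _) ?_ (k := fun i => k (f i).1 (f i).2) ?_ 0 1
    · simpa [hf0, hf1] using this
    -- The constants are values at `t = 1` of the homography `(p, q) ↦ (p T₀ + q W₀) / (p S₀ + q
    -- R₀)`, up to `μ / ν`; it is injective since its determinant is nonzero.
    · intro i j hij
      by_contra hne
      dsimp only at hij
      have e1 := hk (f i).1 (f i).2 1 one_ne_zero
      have e2 := hk (f j).1 (f j).2 1 one_ne_zero
      rw [hF1, hG1, one_zpow, mul_one] at e1 e2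
      rw [hij] at e1
      have hne' : (p (f i).1 (f i).2 * q (f j).1 (f j).2 -
        q (f i).1 (f i).2 * p (f j).1 (f j).2 : ℂ) ≠ 0 := by exact_mod_cast hf i j hne
      have : μ * ν * ((p (f i).1 (f i).2 * q (f j).1 (f j).2 -
        q (f i).1 (f i).2 * p (f j).1 (f j).2) * (T₀ * R₀ - W₀ * S₀)) = 0 := by
        linear_combination
          ν * (p (f j).1 (f j).2 * S₀ + q (f j).1 (f j).2 * R₀) * e1 -
          ν * (p (f i).1 (f i).2 * S₀ + q (f i).1 (f i).2 * R₀) * e2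
      exact mul_ne_zero (mul_ne_zero hμ hν) (mul_ne_zero hne' hTS) this
    · intro t ht
      refine ⟨T.eval t, W.eval t, S.eval t, R.eval t, ?_, fun j => ?_⟩
      · rintro ⟨h0, h0', -, -⟩
        obtain ⟨a, b, hab⟩ := hTW
        have := congrArg (eval t) hab
        simp [h0, h0'] at this
      · have := hk (f j).1 (f j).2 t ht
        simpa [hF, hG] using this
  -- With `k 0 0 = k 0 1` the first angle equation no longer involves `t` on the side of the
  -- quotients `F / G`, which is incompatible with `α 0 ≠ 0`.
  have hpoly : X * ((C (c 0 0) * X ^ (-α 0).toNat - C (x 0 * c 0 1) * X ^ (α 0).toNat) *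
      (G 0 0 * G 0 1)) = 0 := by
    apply Polynomial.funext
    intro t
    by_cases ht : t = 0
    · simp [ht]
    have e := congrArg (eval t) (h 0)
    change eval t (X ^ (-α 0).toNat * (F 0 0 * G 0 1)) =
      eval t (C (x 0) * X ^ (α 0).toNat * (F 0 1 * G 0 0)) at e
    simp only [eval_mul, eval_pow, eval_X, eval_C, eval_sub, eval_zero, hk _ _ t ht, hk01] at e ⊢
    have : t ^ k 0 1 * ((c 0 0 * t ^ (-α 0).toNat - x 0 * c 0 1 * t ^ (α 0).toNat) *
      ((G 0 0).eval t * (G 0 1).eval t)) = 0 := by linear_combination e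
    rw [(mul_eq_zero.1 this).resolve_left (zpow_ne_zero _ ht), mul_zero]
  have hpoly' := (mul_eq_zero.1 ((mul_eq_zero.1 hpoly).resolve_left X_ne_zero)).resolve_right
    (mul_ne_zero (hGne 0 0) (hGne 0 1))
  have := congrArg (fun g => coeff g (-α 0).toNat) hpoly'
  simp only [coeff_sub, coeff_C_mul, coeff_X_pow, coeff_zero, if_true] at this
  rw [if_neg (by omega)] at this
  exact hc 0 0 (by linear_combination this)

/-! ### Three pairs of lines with independent quadratic forms -/

theorem degreeOf_cotForm_le (β : Fin 3 → ℚ) (i : Fin 3) :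
    (cotForm (fun j => MvPolynomial.C (β j)) (fun j => 1 + MvPolynomial.X j)
      (fun j => 1 - MvPolynomial.X j) : MvPolynomial (Fin 3) ℚ).degreeOf i ≤ 1 := by
  have hX : ∀ j, (MvPolynomial.X j : MvPolynomial (Fin 3) ℚ).degreeOf i ≤ if i = j then 1 else 0 :=
    fun j => by rw [MvPolynomial.degreeOf_X]
  have h1 : (1 : MvPolynomial (Fin 3) ℚ).degreeOf i = 0 := MvPolynomial.degreeOf_one i
  have hA : ∀ j, (1 + MvPolynomial.X j : MvPolynomial (Fin 3) ℚ).degreeOf i ≤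
      if i = j then 1 else 0 := fun j =>
    (MvPolynomial.degreeOf_add_le _ _ _).trans (max_le (by rw [h1]; exact Nat.zero_le _) (hX j))
  have hB : ∀ j, (1 - MvPolynomial.X j : MvPolynomial (Fin 3) ℚ).degreeOf i ≤
      if i = j then 1 else 0 := fun j =>
    (MvPolynomial.degreeOf_sub_le _ _ _).trans (max_le (by rw [h1]; exact Nat.zero_le _) (hX j))
  have hterm : ∀ a b c : Fin 3, a ≠ b → a ≠ c → b ≠ c →
      (MvPolynomial.C (β a) * (1 + MvPolynomial.X a) * ((1 - MvPolynomial.X b) *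
        (1 - MvPolynomial.X c)) : MvPolynomial (Fin 3) ℚ).degreeOf i ≤ 1 := by
    intro a b c hab hac hbc
    refine (MvPolynomial.degreeOf_mul_le _ _ _).trans ?_
    refine (Nat.add_le_add (MvPolynomial.degreeOf_mul_le _ _ _)
      (MvPolynomial.degreeOf_mul_le _ _ _)).trans ?_
    rw [MvPolynomial.degreeOf_C]
    have h1 := hA a
    have h2 := hB b
    have h3 := hB c
    split_ifs at h1 h2 h3 <;> omega
  exact (MvPolynomial.degreeOf_add_le _ _ _).trans (max_le ((MvPolynomial.degreeOf_add_le _ _ _).trans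
    (max_le (hterm 0 1 2 (by decide) (by decide) (by decide))
      (hterm 1 0 2 (by decide) (by decide) (by decide))))
    (hterm 2 0 1 (by decide) (by decide) (by decide)))

theorem degreeOf_prod_one_sub_le (i : Fin 3) :
    ((1 - MvPolynomial.X 0) * ((1 - MvPolynomial.X 1) * (1 - MvPolynomial.X 2)) :
      MvPolynomial (Fin 3) ℚ).degreeOf i ≤ 1 := by
  have hB : ∀ j, (1 - MvPolynomial.X j : MvPolynomial (Fin 3) ℚ).degreeOf i ≤
      if i = j then 1 else 0 := fun j =>
    (MvPolynomial.degreeOf_sub_le _ _ _).trans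
      (max_le (by rw [MvPolynomial.degreeOf_one]; exact Nat.zero_le _)
        (by rw [MvPolynomial.degreeOf_X]))
  refine (MvPolynomial.degreeOf_mul_le _ _ _).trans ?_
  refine (Nat.add_le_add_left (MvPolynomial.degreeOf_mul_le _ _ _) _).trans ?_
  have h1 := hB 0
  have h2 := hB 1
  have h3 := hB 2
  split_ifs at h1 h2 h3 <;> omega

theorem degreeOf_quadratic_le {M₀ M₁ M₂ M₃ : MvPolynomial (Fin 3) ℚ} {i : Fin 3}
    (h₀ : M₀.degreeOf i ≤ 1) (h₁ : M₁.degreeOf i ≤ 1) (h₂ : M₂.degreeOf i ≤ 1)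
    (h₃ : M₃.degreeOf i ≤ 1) (c : ℚ) :
    (M₀ * M₂ - M₁ * M₁ + MvPolynomial.C c * (M₃ * M₃)).degreeOf i ≤ 2 := by
  have hm : ∀ {A B : MvPolynomial (Fin 3) ℚ}, A.degreeOf i ≤ 1 → B.degreeOf i ≤ 1 →
      (A * B).degreeOf i ≤ 2 := fun hA hB =>
    (MvPolynomial.degreeOf_mul_le _ _ _).trans (by omega)
  refine (MvPolynomial.degreeOf_add_le _ _ _).trans (max_le
    ((MvPolynomial.degreeOf_sub_le _ _ _).trans (max_le (hm h₀ h₂) (hm h₁ h₁))) ?_)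
  refine (MvPolynomial.degreeOf_mul_le _ _ _).trans ?_
  rw [MvPolynomial.degreeOf_C, zero_add]
  exact hm h₃ h₃

/-- The matrix of the quadratic forms that vanish on the pairs of lines. -/
def pairMatrix (p q : Fin 3 → Fin 2 → ℚ) : Matrix (Fin 3) (Fin 3) ℚ :=
  Matrix.of fun j => ![p j 0 * p j 1, p j 0 * q j 1 + q j 0 * p j 1, q j 0 * q j 1]

/-- With `δ = T R - W S`, the angle equations are linear in `v = (T S, (T R + W S) / 2, W R)`: `(1 -
x j) (K v) j = -(d j / 2) (1 + x j) δ`. Inverting `K` expresses `v / δ` rationally in the `x j`, and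
the identity `v₁² - v₀ v₂ = δ² / 4` becomes the relation between the roots of unity. A deformation
of it is lifted back to polynomials `T, W, S, R`. -/
theorem pow_eq_one_of_det_ne_zero {p q : Fin 3 → Fin 2 → ℚ}
    (hd : ∀ j, p j 0 * q j 1 - q j 0 * p j 1 ≠ 0) (hK : (pairMatrix p q).det ≠ 0)
    {x : Fin 3 → ℂ} (hx : ∀ j, RationalAngles.IsRootOfUnity (x j))
    {T₀ W₀ S₀ R₀ : ℂ} (hTS : T₀ * R₀ - W₀ * S₀ ≠ 0) (hT₀ : T₀ ≠ 0) (hS₀ : S₀ ≠ 0)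
    (hF₀ : ∀ j s, (p j s * T₀ + q j s * W₀ : ℂ) ≠ 0)
    (hG₀ : ∀ j s, (p j s * S₀ + q j s * R₀ : ℂ) ≠ 0)
    (h₀ : ∀ j, (p j 0 * T₀ + q j 0 * W₀) * (p j 1 * S₀ + q j 1 * R₀) =
      x j * ((p j 1 * T₀ + q j 1 * W₀) * (p j 0 * S₀ + q j 0 * R₀)))
    (f : Fin 5 → Fin 3 × Fin 2) (hf0 : f 0 = (0, 0)) (hf1 : f 1 = (0, 1))
    (hf : ∀ i j, i ≠ j → p (f i).1 (f i).2 * q (f j).1 (f j).2 -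
      q (f i).1 (f i).2 * p (f j).1 (f j).2 ≠ 0) :
    ∃ m : ℕ, 0 < m ∧ m ≤ 48 * primorial 27 ∧ x 0 ^ m = 1 := by
  have hx0 : ∀ j, x j ≠ 0 := by
    intro j h0
    obtain ⟨n, hn, h1⟩ := hx j
    rw [h0, zero_pow hn.ne'] at h1
    exact zero_ne_one h1
  have hdC : ∀ j, (p j 0 * q j 1 - q j 0 * p j 1 : ℂ) ≠ 0 := fun j => by exact_mod_cast hd j
  have hx1 : ∀ j, 1 - x j ≠ 0 := by
    intro j h1
    have : (p j 0 * q j 1 - q j 0 * p j 1 : ℂ) * (T₀ * R₀ - W₀ * S₀) = 0 := by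
      linear_combination h₀ j - (p j 1 * T₀ + q j 1 * W₀) * (p j 0 * S₀ + q j 0 * R₀) * h1
    exact mul_ne_zero (hdC j) hTS this
  set K := pairMatrix p q with hKdef
  set d : Fin 3 → ℚ := fun j => p j 0 * q j 1 - q j 0 * p j 1 with hd_def
  set k : Fin 3 → Fin 3 → ℚ := fun i j => -(K⁻¹ i j * d j / 2) with hk
  have hKK : ∀ i l, ∑ j, K⁻¹ i j * K j l = if i = l then 1 else 0 := by
    intro i l
    have := congrFun (congrFun (Matrix.nonsing_inv_mul K (isUnit_iff_ne_zero.2 hK)) i) l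
    simpa [Matrix.mul_apply, Matrix.one_apply] using this
  have hKk : ∀ j l, ∑ i, K j i * k i l = if j = l then -(d l / 2) else 0 := by
    intro j l
    have := congrFun (congrFun (Matrix.mul_nonsing_inv K (isUnit_iff_ne_zero.2 hK)) j) l
    simp only [Matrix.mul_apply, Matrix.one_apply] at this
    calc ∑ i, K j i * k i l = -(d l / 2) * ∑ i, K j i * K⁻¹ i l := by
          rw [Finset.mul_sum]
          exact Finset.sum_congr rfl fun i _ => by simp only [hk]; ring
      _ = _ := by rw [this]; split_ifs <;> simp
  set M : Fin 3 → MvPolynomial (Fin 3) ℚ := fun i =>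
    cotForm (fun j => MvPolynomial.C (k i j)) (fun j => 1 + MvPolynomial.X j)
      (fun j => 1 - MvPolynomial.X j) with hM
  set M' : MvPolynomial (Fin 3) ℚ :=
    (1 - MvPolynomial.X 0) * ((1 - MvPolynomial.X 1) * (1 - MvPolynomial.X 2)) with hM'
  have hMev : ∀ (z : Fin 3 → ℂ) i, (M i).aeval z =
      cotForm (fun j => (k i j : ℂ)) (fun j => 1 + z j) (fun j => 1 - z j) := by
    intro z i
    simp [hM, cotForm]
  have hMev' : ∀ z : Fin 3 → ℂ, M'.aeval z = (1 - z 0) * ((1 - z 1) * (1 - z 2)) := by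
    intro z
    simp [hM']
  -- the solution of the linear system at the base point
  set δ := T₀ * R₀ - W₀ * S₀ with hδ
  set v : Fin 3 → ℂ := ![T₀ * S₀, (T₀ * R₀ + W₀ * S₀) / 2, W₀ * R₀] with hv
  have hw : ∀ j, (1 - x j) * ∑ i, (K j i : ℂ) * v i = -(d j / 2) * (1 + x j) * δ := by
    intro j
    have := h₀ j
    simp [hKdef, pairMatrix, hv, Fin.sum_univ_three, hd_def, hδ]
    linear_combination this
  have hbase : ∀ i, δ * (M i).aeval x = M'.aeval x * v i := by
    intro i
    have hvi : v i = ∑ j, (K⁻¹ i j : ℂ) * ∑ l, (K j l : ℂ) * v l := by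
      simp_rw [Finset.mul_sum, ← mul_assoc]
      rw [Finset.sum_comm]
      have hKC : ∀ l, ∑ j, (K⁻¹ i j : ℂ) * (K j l : ℂ) = if i = l then 1 else 0 := by
        intro l
        have := hKK i l
        have h2 := congrArg (fun r : ℚ => (r : ℂ)) this
        push_cast at h2
        rw [h2]
        split_ifs <;> simp
      simp_rw [← Finset.sum_mul, hKC]
      simp
    rw [hMev, hMev', hvi, Fin.sum_univ_three]
    have w0 := hw 0
    have w1 := hw 1
    have w2 := hw 2
    simp only [cotForm, hk]
    push_cast
    linear_combination
      -((K⁻¹ i 0 : ℂ) * ((1 - x 1) * (1 - x 2))) * w0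
      - ((K⁻¹ i 1 : ℂ) * ((1 - x 0) * (1 - x 2))) * w1
      - ((K⁻¹ i 2 : ℂ) * ((1 - x 0) * (1 - x 1))) * w2
  have hM'x : M'.aeval x ≠ 0 := by
    rw [hMev']
    exact mul_ne_zero (hx1 0) (mul_ne_zero (hx1 1) (hx1 2))
  have hP0 : (M 0 * M 2 - M 1 * M 1 + MvPolynomial.C (1 / 4) * (M' * M')).aeval x = 0 := by
    have : δ ^ 2 * (M 0 * M 2 - M 1 * M 1 + MvPolynomial.C (1 / 4) * (M' * M')).aeval x = 0 := by
      have b0 := hbase 0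
      have b1 := hbase 1
      have b2 := hbase 2
      simp only [map_add, map_sub, map_mul, MvPolynomial.aeval_C]
      simp only [hv, Matrix.cons_val] at b0 b1 b2
      generalize (MvPolynomial.aeval x) (M 0) = m0 at *
      generalize (MvPolynomial.aeval x) (M 1) = m1 at *
      generalize (MvPolynomial.aeval x) (M 2) = m2 at *
      generalize (MvPolynomial.aeval x) M' = m3 at *
      have e : (algebraMap ℚ ℂ) (1 / 4) = 1 / 4 := by simp
      rw [e]
      linear_combination δ * m2 * b0 + m3 * (T₀ * S₀) * b2 -
        (δ * m1 + m3 * ((T₀ * R₀ + W₀ * S₀) / 2)) * b1 +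
        (m3 ^ 2 / 4) * (δ + T₀ * R₀ - W₀ * S₀) * hδ
    exact (mul_eq_zero.1 this).resolve_left (pow_ne_zero 2 hTS)
  rcases exists_pow_eq_one_or_family
    (M 0 * M 2 - M 1 * M 1 + MvPolynomial.C (1 / 4) * (M' * M')) (fun i => degreeOf_quadratic_le (degreeOf_cotForm_le (k 0) i)
    (degreeOf_cotForm_le (k 1) i) (degreeOf_cotForm_le (k 2) i) (degreeOf_prod_one_sub_le i) (1 / 4))
    x hx hP0 with h | ⟨α, hα, hfam⟩
  · exact h
  exfalso
  -- polynomial solution of the linear system along the family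
  set U : Fin 3 → Polynomial ℂ := fun j => Polynomial.C (x j) * Polynomial.X ^ (α j).toNat with hU
  set D : Fin 3 → Polynomial ℂ := fun j => Polynomial.X ^ (-α j).toNat with hD
  set m : Fin 3 → Polynomial ℂ := fun i => cotForm (fun j => Polynomial.C (k i j : ℂ))
    (fun j => D j + U j) (fun j => D j - U j) with hm
  set m' : Polynomial ℂ := (D 0 - U 0) * ((D 1 - U 1) * (D 2 - U 2)) with hm'
  have hUD : ∀ j (t : ℂ), t ≠ 0 → (U j).eval t = (D j).eval t * (x j * t ^ α j) := by
    intro j t ht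
    simp only [hU, hD, Polynomial.eval_mul, Polynomial.eval_C, Polynomial.eval_pow,
      Polynomial.eval_X]
    have : t ^ (α j).toNat = t ^ (-α j).toNat * t ^ α j := by
      rw [← zpow_natCast, ← zpow_natCast, ← zpow_add₀ ht]
      congr 1
      omega
    rw [this]; ring
  have hmev : ∀ i (t : ℂ), t ≠ 0 → (m i).eval t =
      (D 0).eval t * (D 1).eval t * (D 2).eval t * (M i).aeval fun j => x j * t ^ α j := by
    intro i t ht
    rw [hMev]
    simp only [hm, cotForm, Polynomial.eval_add, Polynomial.eval_mul, Polynomial.eval_sub,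
      Polynomial.eval_C, hUD _ t ht]
    ring
  have hmev' : ∀ t : ℂ, t ≠ 0 → m'.eval t =
      (D 0).eval t * (D 1).eval t * (D 2).eval t * M'.aeval fun j => x j * t ^ α j := by
    intro t ht
    rw [hMev']
    simp only [hm', Polynomial.eval_mul, Polynomial.eval_sub, hUD _ t ht]
    ring
  -- The four factors play the roles of `T S`, `W R`, `T R` and `W S`.
  have hquad : m 0 * m 2 = (m 1 + Polynomial.C (1 / 2) * m') * (m 1 - Polynomial.C (1 / 2) * m') := by
    rw [← sub_eq_zero]
    refine (mul_eq_zero.1 (?_ : Polynomial.X * _ = 0)).resolve_left Polynomial.X_ne_zero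
    apply Polynomial.funext
    intro t
    by_cases ht : t = 0
    · simp [ht]
    have := hfam t ht
    simp only [map_add, map_sub, map_mul, MvPolynomial.aeval_C] at this
    have e : (algebraMap ℚ ℂ) (1 / 4) = 1 / 4 := by simp
    rw [e] at this
    simp only [Polynomial.eval_mul, Polynomial.eval_sub, Polynomial.eval_add, Polynomial.eval_C,
      Polynomial.eval_X, Polynomial.eval_zero, hmev _ t ht, hmev' t ht]
    linear_combination t * ((D 0).eval t * (D 1).eval t * (D 2).eval t) ^ 2 * this
  have hx1t : (fun j => x j * (1 : ℂ) ^ α j) = x := by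
    ext j; simp
  have hD1 : (D 0).eval 1 * (D 1).eval 1 * (D 2).eval 1 = 1 := by simp [hD]
  have hm1 : ∀ i, (m i).eval 1 = (M i).aeval x := by
    intro i
    rw [hmev i 1 one_ne_zero, hx1t, hD1, one_mul]
  have hm1' : m'.eval 1 = M'.aeval x := by
    rw [hmev' 1 one_ne_zero, hx1t, hD1, one_mul]
  have hA1 : (m 0).eval 1 ≠ 0 := by
    rw [hm1]
    intro h0
    have := hbase 0
    rw [h0, mul_zero] at this
    exact mul_ne_zero hM'x (mul_ne_zero hT₀ hS₀) this.symm
  have hA : m 0 ≠ 0 := fun h0 => hA1 (by rw [h0, Polynomial.eval_zero])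
  obtain ⟨T, W, S, R, g, hTW, hSR, hg, gA, gB, gC, gE⟩ := exists_coprime_parametrization hA hquad
  have hrow : ∀ j, (D j - U j) * ∑ i, Polynomial.C (K j i : ℂ) * m i =
      - Polynomial.C (d j / 2 : ℂ) * (D j + U j) * m' := by
    intro j
    have hc : ∀ l, ∑ i, Polynomial.C (K j i : ℂ) * Polynomial.C (k i l : ℂ) =
        if j = l then -Polynomial.C (d j / 2 : ℂ) else 0 := by
      intro l
      have h2 := congrArg (fun r : ℚ => Polynomial.C (r : ℂ)) (hKk j l)
      push_cast at h2
      simp only [map_sum, map_mul] at h2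
      rw [h2]
      split_ifs with hjl
      · rw [hjl]; simp
      · simp
    have c0 := hc 0
    have c1 := hc 1
    have c2 := hc 2
    rw [Fin.sum_univ_three] at c0 c1 c2 ⊢
    have hsum : Polynomial.C (K j 0 : ℂ) * m 0 + Polynomial.C (K j 1 : ℂ) * m 1 +
        Polynomial.C (K j 2 : ℂ) * m 2 =
        cotForm (fun l => if j = l then -Polynomial.C (d j / 2 : ℂ) else 0)
          (fun j => D j + U j) (fun j => D j - U j) := by
      simp only [hm, cotForm]
      rw [← c0, ← c1, ← c2]
      ring
    rw [hsum]
    fin_cases j <;> simp [cotForm, hm'] <;> ring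
  refine not_exists_polynomial_family hd hx0 hα hTS hT₀ hS₀ hF₀ hG₀ hTW hSR ?_ ?_ ?_ f hf0 hf1 hf
  · have e : T * (m 1 - Polynomial.C (1 / 2) * m') = W * m 0 := by
      apply mul_left_cancel₀ hA
      linear_combination T * gC - W * gA
    have e1 := congrArg (Polynomial.eval 1) e
    simp only [Polynomial.eval_mul, Polynomial.eval_sub, Polynomial.eval_C, hm1, hm1'] at e1
    have b0 := hbase 0
    have b1 := hbase 1
    simp only [hv, Matrix.cons_val] at b0 b1
    apply mul_left_cancel₀ (mul_ne_zero hM'x hS₀)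
    linear_combination δ * e1 - T.eval 1 * b1 + W.eval 1 * b0 +
      T.eval 1 * M'.aeval x / 2 * hδ
  · have e : S * (m 1 + Polynomial.C (1 / 2) * m') = R * m 0 := by
      apply mul_left_cancel₀ hA
      linear_combination S * gB - R * gA
    have e1 := congrArg (Polynomial.eval 1) e
    simp only [Polynomial.eval_mul, Polynomial.eval_add, Polynomial.eval_C, hm1, hm1'] at e1
    have b0 := hbase 0
    have b1 := hbase 1
    simp only [hv, Matrix.cons_val] at b0 b1
    apply mul_left_cancel₀ (mul_ne_zero hM'x hT₀)
    linear_combination δ * e1 - S.eval 1 * b1 + R.eval 1 * b0 -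
      S.eval 1 * M'.aeval x / 2 * hδ
  · intro j
    have hr := hrow j
    have k0 : Polynomial.C (K j 0 : ℂ) = Polynomial.C (p j 0 : ℂ) * Polynomial.C (p j 1 : ℂ) := by
      simp [hKdef, pairMatrix]
    have k1 : Polynomial.C (K j 1 : ℂ) = Polynomial.C (p j 0 : ℂ) * Polynomial.C (q j 1 : ℂ) +
        Polynomial.C (q j 0 : ℂ) * Polynomial.C (p j 1 : ℂ) := by
      simp [hKdef, pairMatrix]
    have k2 : Polynomial.C (K j 2 : ℂ) = Polynomial.C (q j 0 : ℂ) * Polynomial.C (q j 1 : ℂ) := by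
      simp [hKdef, pairMatrix]
    have kd : Polynomial.C (d j / 2 : ℂ) = (Polynomial.C (p j 0 : ℂ) * Polynomial.C (q j 1 : ℂ) -
        Polynomial.C (q j 0 : ℂ) * Polynomial.C (p j 1 : ℂ)) * Polynomial.C (1 / 2) := by
      rw [← Polynomial.C_mul, ← Polynomial.C_mul, ← Polynomial.C_sub, ← Polynomial.C_mul]
      congr 1
      simp only [hd_def]
      push_cast
      ring
    rw [Fin.sum_univ_three, k0, k1, k2, kd] at hr
    change D j * _ = U j * _
    apply mul_left_cancel₀ hg
    clear_value m m' D U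
    linear_combination m 0 * hr -
      (D j - U j) * (Polynomial.C (p j 0 : ℂ) * Polynomial.C (p j 1 : ℂ)) * gA -
      (D j * (Polynomial.C (p j 0 : ℂ) * Polynomial.C (q j 1 : ℂ)) -
        U j * (Polynomial.C (p j 1 : ℂ) * Polynomial.C (q j 0 : ℂ))) * gB -
      (D j * (Polynomial.C (q j 0 : ℂ) * Polynomial.C (p j 1 : ℂ)) -
        U j * (Polynomial.C (q j 1 : ℂ) * Polynomial.C (p j 0 : ℂ))) * gC -
      (D j - U j) * (Polynomial.C (q j 0 : ℂ) * Polynomial.C (q j 1 : ℂ)) * gE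

/-! ### Dependencies between the quadratic forms of three pairs -/

theorem Fin.univ_three_eq {i j k : Fin 3} (hij : i ≠ j) (hik : i ≠ k) (hjk : j ≠ k) :
    (Finset.univ : Finset (Fin 3)) = {i, j, k} := by
  revert i j k
  decide

theorem Fin.exists_ne_of_three (i j : Fin 3) : ∃ k, i ≠ k ∧ j ≠ k := by
  revert i j
  decide

theorem sum_brackets_eq_zero {p q : Fin 3 → Fin 2 → ℚ} {c : Fin 3 → ℚ}
    (hc : Matrix.vecMul c (pairMatrix p q) = 0) (z z' : ℚ) :
    ∑ j, c j * ((p j 0 * z' - q j 0 * z) * (p j 1 * z' - q j 1 * z)) = 0 := by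
  have h0 := congrFun hc 0
  have h1 := congrFun hc 1
  have h2 := congrFun hc 2
  simp [Matrix.vecMul, dotProduct, Fin.sum_univ_three, pairMatrix] at h0 h1 h2
  rw [Fin.sum_univ_three]
  linear_combination z' * z' * h0 - z * z' * h1 + z * z * h2

/-- The dependency kills the symmetric part of the tensor `∑ c j • ℓ j 0 ⊗ ℓ j 1`, where `ℓ j s` is
the linear form of the line, and `hs` kills the antisymmetric part. -/
theorem sum_bilinear_brackets_eq_zero {p q : Fin 3 → Fin 2 → ℚ} {c : Fin 3 → ℚ}
    (hc : Matrix.vecMul c (pairMatrix p q) = 0)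
    (hs : ∑ j, c j * (p j 0 * q j 1 - q j 0 * p j 1) = 0) (z z' w w' : ℚ) :
    ∑ j, c j * ((p j 0 * z' - q j 0 * z) * (p j 1 * w' - q j 1 * w)) = 0 := by
  have h0 := congrFun hc 0
  have h1 := congrFun hc 1
  have h2 := congrFun hc 2
  simp [Matrix.vecMul, dotProduct, Fin.sum_univ_three, pairMatrix] at h0 h1 h2
  rw [Fin.sum_univ_three] at hs ⊢
  linear_combination z' * w' * h0 - (z' * w + z * w') / 2 * h1 + z * w * h2 -
    (z' * w - z * w') / 2 * hs

/-- At the line common to pairs `i` and `j` a dependency reduces to its term `k`; at their remaining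
lines it then isolates `c j` and `c i`. -/
theorem pairMatrix_det_ne_zero_of_common {p q : Fin 3 → Fin 2 → ℚ} {i j k : Fin 3}
    (hij : i ≠ j) (hik : i ≠ k) (hjk : j ≠ k)
    (hp : p i 0 = p j 0) (hq : q i 0 = q j 0)
    (hki : ∀ s, p k s * q i 0 - q k s * p i 0 ≠ 0)
    (hi : p i 0 * q i 1 - q i 0 * p i 1 ≠ 0) (hj : p j 0 * q j 1 - q j 0 * p j 1 ≠ 0)
    (hr : p i 1 * q j 1 - q i 1 * p j 1 ≠ 0) : (pairMatrix p q).det ≠ 0 := by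
  intro h
  obtain ⟨c, hc0, hc⟩ := Matrix.exists_vecMul_eq_zero_iff.2 h
  have huniv := Fin.univ_three_eq hij hik hjk
  have key := sum_brackets_eq_zero hc
  simp only [huniv, Finset.sum_insert (show i ∉ ({j, k} : Finset (Fin 3)) by simp [hij, hik]),
    Finset.sum_insert (show j ∉ ({k} : Finset (Fin 3)) by simp [hjk]), Finset.sum_singleton] at key
  have ck : c k = 0 := by
    have := key (p i 0) (q i 0)
    rw [← hp, ← hq] at this
    have h' : c k * ((p k 0 * q i 0 - q k 0 * p i 0) * (p k 1 * q i 0 - q k 1 * p i 0)) = 0 := by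
      linear_combination this
    exact (mul_eq_zero.1 h').resolve_right (mul_ne_zero (hki 0) (hki 1))
  have cj : c j = 0 := by
    have := key (p i 1) (q i 1)
    rw [ck, ← hp, ← hq] at this
    have h' : c j * ((p i 0 * q i 1 - q i 0 * p i 1) * (p i 1 * q j 1 - q i 1 * p j 1)) = 0 := by
      linear_combination -this
    exact (mul_eq_zero.1 h').resolve_right (mul_ne_zero hi hr)
  have ci : c i = 0 := by
    have := key (p j 1) (q j 1)
    rw [ck, cj, hp, hq] at this
    have h' : c i * ((p j 0 * q j 1 - q j 0 * p j 1) * (p i 1 * q j 1 - q i 1 * p j 1)) = 0 := by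
      linear_combination this
    exact (mul_eq_zero.1 h').resolve_right (mul_ne_zero hj hr)
  apply hc0
  ext l
  have : l ∈ ({i, j, k} : Finset (Fin 3)) := huniv ▸ Finset.mem_univ l
  simp only [Finset.mem_insert, Finset.mem_singleton] at this
  rcases this with rfl | rfl | rfl <;> simpa

theorem coeff_ne_zero_of_vecMul_pairMatrix {p q : Fin 3 → Fin 2 → ℚ} {c : Fin 3 → ℚ}
    (hpq : ∀ a b : Fin 3 × Fin 2, a ≠ b →
      p a.1 a.2 * q b.1 b.2 - q a.1 a.2 * p b.1 b.2 ≠ 0) (hc0 : c ≠ 0)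
    (hc : Matrix.vecMul c (pairMatrix p q) = 0) (i : Fin 3) : c i ≠ 0 := by
  have step : ∀ i j k : Fin 3, i ≠ j → i ≠ k → j ≠ k → c i = 0 → c j = 0 := by
    intro i j k hij hik hjk hi
    have huniv := Fin.univ_three_eq hij hik hjk
    have := sum_brackets_eq_zero hc (p k 0) (q k 0)
    rw [huniv, Finset.sum_insert (by simp [hij, hik]), Finset.sum_insert (by simp [hjk]),
      Finset.sum_singleton, hi] at this
    have h' : c j * ((p j 0 * q k 0 - q j 0 * p k 0) * (p j 1 * q k 0 - q j 1 * p k 0)) = 0 := by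
      linear_combination this
    exact (mul_eq_zero.1 h').resolve_right (mul_ne_zero (hpq (j, 0) (k, 0) (by simp [hjk]))
      (hpq (j, 1) (k, 0) (by simp [hjk])))
  intro hi
  apply hc0
  ext j
  by_cases hij : i = j
  · rw [← hij]; exact hi
  · obtain ⟨k, hik, hjk⟩ := Fin.exists_ne_of_three i j
    exact step i j k hij hik hjk hi

/-- Otherwise the whole bilinear tensor vanishes; evaluated at a first line of pair 0 and a second
line of pair 1, it retains only the nonzero term of pair 2. -/
theorem sum_coeff_mul_bracket_ne_zero {p q : Fin 3 → Fin 2 → ℚ} {c : Fin 3 → ℚ}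
    (hpq : ∀ a b : Fin 3 × Fin 2, a ≠ b →
      p a.1 a.2 * q b.1 b.2 - q a.1 a.2 * p b.1 b.2 ≠ 0) (hc0 : c ≠ 0)
    (hc : Matrix.vecMul c (pairMatrix p q) = 0) :
    ∑ j, c j * (p j 0 * q j 1 - q j 0 * p j 1) ≠ 0 := by
  intro hs
  have := sum_bilinear_brackets_eq_zero hc hs (p 0 0) (q 0 0) (p 1 1) (q 1 1)
  rw [Fin.sum_univ_three] at this
  have h' : c 2 * ((p 2 0 * q 0 0 - q 2 0 * p 0 0) * (p 2 1 * q 1 1 - q 2 1 * p 1 1)) = 0 := by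
    linear_combination this
  exact mul_ne_zero (coeff_ne_zero_of_vecMul_pairMatrix hpq hc0 hc 2)
    (mul_ne_zero (hpq (2, 0) (0, 0) (by decide)) (hpq (2, 1) (1, 1) (by decide))) h'

/-- Exchanging the two lines of a pair negates its bracket and preserves its quadratic form. -/
theorem signed_sum_coeff_mul_bracket_ne_zero {p q : Fin 3 → Fin 2 → ℚ} {c : Fin 3 → ℚ}
    (hpq : ∀ a b : Fin 3 × Fin 2, a ≠ b →
      p a.1 a.2 * q b.1 b.2 - q a.1 a.2 * p b.1 b.2 ≠ 0) (hc0 : c ≠ 0)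
    (hc : Matrix.vecMul c (pairMatrix p q) = 0) (ε : Fin 3 → ℤˣ) :
    ∑ j, ((ε j : ℤ) : ℚ) * (c j * (p j 0 * q j 1 - q j 0 * p j 1)) ≠ 0 := by
  set s : Fin 3 → Fin 2 → Fin 2 := fun j i => if ε j = 1 then i else 1 - i with hs
  have hsi : ∀ j, Function.Injective (s j) := by
    intro j
    simp only [hs]
    split_ifs <;> decide
  have := sum_coeff_mul_bracket_ne_zero (p := fun j i => p j (s j i)) (q := fun j i => q j (s j i))
    (c := c) (fun a b hab => hpq (a.1, s a.1 a.2) (b.1, s b.1 b.2) (by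
      intro h
      rw [Prod.ext_iff] at h
      obtain ⟨h1, h2⟩ := h
      simp only at h1 h2
      rw [← h1] at h2
      exact hab (Prod.ext h1 (hsi _ h2)))) hc0 (by
      rw [← hc]
      congr 1
      ext j i
      rcases Int.units_eq_one_or (ε j) with h | h <;> fin_cases i <;>
        simp [pairMatrix, hs, h] <;> ring)
  refine fun h0 => this ?_
  rw [← h0]
  apply Finset.sum_congr rfl
  intro j _
  rcases Int.units_eq_one_or (ε j) with h | h <;> simp [hs, h]
  ring

/-- If the quadratic forms of three pairs of lines are dependent, with coefficients `b`, `c` for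
two of them in coordinates given by the third pair, then these two pairs cannot be harmonic to the
third one. -/
theorem not_harmonic_of_dependent {b c P₀ P₁ Q₀ Q₁ p₀ p₁ q₀ q₁ : ℚ} (hb : b ≠ 0)
    (hQ₀ : Q₀ ≠ 0) (hQ₁ : Q₁ ≠ 0) (h₁ : b * (P₀ * P₁) + c * (p₀ * p₁) = 0)
    (h₂ : b * (Q₀ * Q₁) + c * (q₀ * q₁) = 0)
    (h₃ : b * (P₀ * Q₁ - Q₀ * P₁) + c * (p₀ * q₁ - q₀ * p₁) = 0)
    (hne : P₀ * q₀ - Q₀ * p₀ ≠ 0) : P₀ * Q₁ + Q₀ * P₁ ≠ 0 := by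
  intro h
  have : b * Q₀ * Q₁ * (P₀ * q₀ - Q₀ * p₀) ^ 2 = 0 := by
    linear_combination (-Q₀ ^ 2 * q₀ ^ 2) * h₁ + Q₀ ^ 2 * p₀ ^ 2 * h₂ - Q₀ ^ 2 * (p₀ * q₀) * h₃ +
      (b * q₀ ^ 2 * P₀ * Q₀ - b * Q₀ ^ 2 * p₀ * q₀) * h
  simp_all

/-! ### Lines, commensurability and recognition of the two families -/

namespace RationalAngles

open ComplexConjugate

/-- The square of the direction of `v`; it determines the real line spanned by `v`. -/
noncomputable def lineArg (v : ℂ) : ℂ := v / conj v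

theorem lineArg_ne_zero {v : ℂ} (hv : v ≠ 0) : lineArg v ≠ 0 :=
  div_ne_zero hv (by simpa using hv)

theorem lineArg_eq_iff {v w : ℂ} (hv : v ≠ 0) (hw : w ≠ 0) :
    lineArg v = lineArg w ↔ v * conj w = w * conj v := by
  rw [lineArg, lineArg, div_eq_div_iff (by simpa using hv) (by simpa using hw)]

theorem lineArg_mul_conj {v : ℂ} (hv : v ≠ 0) : lineArg v * conj v = v :=
  div_mul_cancel₀ _ (by simpa using hv)

theorem lineArg_div_lineArg (v w : ℂ) : lineArg w / lineArg v = lineArg (w / v) := by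
  simp only [lineArg, map_div₀]
  by_cases hv : v = 0
  · simp [hv]
  by_cases hw : w = 0
  · simp [hw]
  have hv' : conj v ≠ 0 := by simpa using hv
  have hw' : conj w ≠ 0 := by simpa using hw
  field_simp

theorem lineArg_eq_exp {z : ℂ} (hz : z ≠ 0) :
    lineArg z = Complex.exp (2 * Complex.arg z * Complex.I) := by
  have h := Complex.norm_mul_exp_arg_mul_I z
  have hn : (‖z‖ : ℂ) ≠ 0 := by simpa using hz
  have hc : conj z = ‖z‖ * Complex.exp (-(Complex.arg z * Complex.I)) := by
    conv_lhs => rw [← h]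
    rw [map_mul, Complex.conj_ofReal, ← Complex.exp_conj, map_mul, Complex.conj_ofReal,
      Complex.conj_I, mul_neg]
  rw [lineArg, hc]
  conv_lhs => enter [1]; rw [← h]
  rw [mul_div_mul_left _ _ hn, ← Complex.exp_sub]
  congr 1
  ring

theorem IsRootOfUnity.inv {y : ℂ} (h : IsRootOfUnity y) : IsRootOfUnity y⁻¹ := by
  obtain ⟨n, hn, h⟩ := h
  exact ⟨n, hn, by rw [inv_pow, h, inv_one]⟩

theorem IsRootOfUnity.mul {y z : ℂ} (hy : IsRootOfUnity y) (hz : IsRootOfUnity z) :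
    IsRootOfUnity (y * z) := by
  obtain ⟨n, hn, hy⟩ := hy
  obtain ⟨m, hm, hz⟩ := hz
  refine ⟨n * m, by positivity, ?_⟩
  rw [mul_pow, pow_mul, hy, one_pow, mul_comm n, pow_mul, hz, one_pow, one_mul]

theorem isRootOfUnity_neg_one : IsRootOfUnity (-1) := ⟨2, by norm_num, by norm_num⟩

/-- The lines through `v` and `w` differ by a rational angle, possibly zero. -/
def Commensurable (v w : ℂ) : Prop := IsRootOfUnity (lineArg v / lineArg w)

theorem Commensurable.symm {v w : ℂ} (h : Commensurable v w) : Commensurable w v := by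
  have := h.inv
  rwa [inv_div] at this

theorem Commensurable.trans {u v w : ℂ} (hv : v ≠ 0) (h : Commensurable u v)
    (h' : Commensurable v w) : Commensurable u w := by
  have := h.mul h'
  rwa [div_mul_div_cancel₀ (lineArg_ne_zero hv)] at this

theorem IsRationalAngle.commensurable {v w : ℂ} (h : IsRationalAngle v w) :
    Commensurable v w := by
  obtain ⟨hv, hw, -, r, hr⟩ := h
  apply Commensurable.symm
  refine ⟨r.den, r.pos, ?_⟩
  rw [lineArg_div_lineArg, lineArg_eq_exp (div_ne_zero hw hv), hr, ← Complex.exp_nat_mul,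
    Complex.exp_eq_one_iff]
  refine ⟨r.num, ?_⟩
  have hd : (r.den : ℂ) * (r : ℂ) = r.num := by exact_mod_cast Rat.den_mul_eq_num r
  push_cast
  linear_combination (2 * Real.pi * Complex.I : ℂ) * hd

theorem IsRationalAngle.lineArg_ne {v w : ℂ} (h : IsRationalAngle v w) :
    lineArg v ≠ lineArg w := by
  obtain ⟨hv, hw, him, -⟩ := h
  intro he
  rw [lineArg_eq_iff hv hw] at he
  apply him
  have hv' : conj v ≠ 0 := by simpa using hv
  rw [← Complex.conj_eq_iff_im, map_div₀, div_eq_div_iff hv' hv]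
  linear_combination he

theorem span_eq_of_lineArg_eq {v w : ℂ} (hv : v ≠ 0) (hw : w ≠ 0) (h : lineArg v = lineArg w) :
    Submodule.span ℝ {v} = Submodule.span ℝ {w} := by
  rw [lineArg_eq_iff hv hw] at h
  have hv' : conj v ≠ 0 := by simpa using hv
  have him : (w / v).im = 0 := by
    rw [← Complex.conj_eq_iff_im, map_div₀, div_eq_div_iff hv' hv]
    linear_combination h
  have hre : ((w / v).re : ℂ) = w / v := Complex.ext (by simp) (by simp [him])
  have hw' : w = (w / v).re • v := by
    rw [Complex.real_smul, hre]
    field_simp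
  have hne : (w / v).re ≠ 0 := by
    intro h0
    rw [h0, zero_smul] at hw'
    exact hw hw'
  rw [hw', Submodule.span_singleton_smul_eq (isUnit_iff_ne_zero.2 hne)]

/-- `lineArg` doubles angles, hence `2 * m` and not `m`. -/
theorem dvd_of_lineArg_pow_eq_one {v w : ℂ} (hv : v ≠ 0) (hw : w ≠ 0) {a : ℤ} {b : ℕ} (hb : 0 < b)
    (hab : IsCoprime a (b : ℤ))
    (h : (Complex.arg (w / v) : Real.Angle) =
      (((a : ℝ) / (b : ℝ) * (2 * Real.pi) : ℝ) : Real.Angle))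
    {m : ℕ} (hm : (lineArg v / lineArg w) ^ m = 1) : b ∣ 2 * m := by
  obtain ⟨k, hk⟩ := Real.Angle.angle_eq_iff_two_pi_dvd_sub.1 h
  have h1 : (lineArg w / lineArg v) ^ m = 1 := by
    rw [← inv_div, inv_pow, hm, inv_one]
  rw [lineArg_div_lineArg, lineArg_eq_exp (div_ne_zero hw hv), ← Complex.exp_nat_mul,
    Complex.exp_eq_one_iff] at h1
  obtain ⟨n, hn⟩ := h1
  have harg : (Complex.arg (w / v) : ℂ) = (a : ℂ) / b * (2 * Real.pi) + 2 * Real.pi * k := by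
    have : Complex.arg (w / v) = (a : ℝ) / b * (2 * Real.pi) + 2 * Real.pi * k := by
      linarith
    rw [this]
    push_cast
    ring
  rw [harg] at hn
  have hbC : (b : ℂ) ≠ 0 := by exact_mod_cast hb.ne'
  have hC : (2 * m * a : ℂ) = b * (n - 2 * m * k) := by
    field_simp at hn
    linear_combination hn
  have hZ : (2 * m * a : ℤ) = b * (n - 2 * m * k) := by exact_mod_cast hC
  have hd : (b : ℤ) ∣ 2 * m := by
    apply hab.symm.dvd_of_dvd_mul_right
    exact ⟨_, hZ⟩
  exact_mod_cast hd

theorem eq_span_pair {V : Submodule ℚ ℂ} (hV : IsSpace V) {e₁ e₂ : ℂ} (h₁ : e₁ ∈ V)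
    (h₂ : e₂ ∈ V) (hne₁ : e₁ ≠ 0) (hne₂ : e₂ ≠ 0) (hne : lineArg e₁ ≠ lineArg e₂) :
    V = Submodule.span ℚ {e₁, e₂} := by
  have hli : LinearIndependent ℚ ![e₁, e₂] := by
    rw [LinearIndependent.pair_iff]
    intro s t hst
    have hst' : (s : ℂ) * e₁ + t * e₂ = 0 := by simpa [Algebra.smul_def] using hst
    have hst'' : (s : ℂ) * conj e₁ + t * conj e₂ = 0 := by
      have := congrArg conj hst'
      simpa using this
    rw [Ne, lineArg_eq_iff hne₁ hne₂] at hne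
    have hδ : e₁ * conj e₂ - e₂ * conj e₁ ≠ 0 := sub_ne_zero.2 hne
    have hs : (s : ℂ) * (e₁ * conj e₂ - e₂ * conj e₁) = 0 := by
      linear_combination conj e₂ * hst' - e₂ * hst''
    have ht : (t : ℂ) * (e₁ * conj e₂ - e₂ * conj e₁) = 0 := by
      linear_combination e₁ * hst'' - conj e₁ * hst'
    exact ⟨by exact_mod_cast (mul_eq_zero.1 hs).resolve_right hδ,
      by exact_mod_cast (mul_eq_zero.1 ht).resolve_right hδ⟩
  have : FiniteDimensional ℚ V := FiniteDimensional.of_finrank_pos (by rw [hV.1]; norm_num)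
  symm
  apply Submodule.eq_of_le_of_finrank_eq
  · rw [Submodule.span_le]
    rintro z (rfl | rfl)
    · exact h₁
    · exact h₂
  · rw [hV.1]
    have := finrank_span_eq_card hli
    rwa [Matrix.range_cons_cons_empty, Fintype.card_fin] at this

theorem mem_span_pair_rat {e₁ e₂ z : ℂ} :
    z ∈ Submodule.span ℚ {e₁, e₂} ↔ ∃ p q : ℚ, (p : ℂ) * e₁ + q * e₂ = z := by
  rw [Submodule.mem_span_pair]
  simp [Algebra.smul_def]

theorem homothetic_spaceOf {b c : ℂ} (hb : b ≠ 0) {r : ℚ} (hr : r ≠ 0) :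
    Homothetic (Submodule.span ℚ {b, c}) (spaceOf (r * (c / b))) := by
  refine ⟨b⁻¹, inv_ne_zero hb, ?_⟩
  have hrC : (r : ℂ) ≠ 0 := by exact_mod_cast hr
  ext z
  rw [Submodule.mem_map, spaceOf, mem_span_pair_rat]
  constructor
  · rintro ⟨u, hu, rfl⟩
    obtain ⟨p, q, rfl⟩ := mem_span_pair_rat.1 hu
    refine ⟨p, q / r, ?_⟩
    simp only [LinearMap.mulLeft_apply]
    push_cast
    field_simp
  · rintro ⟨p, q, rfl⟩
    refine ⟨p * b + (q * r : ℚ) * c, mem_span_pair_rat.2 ⟨p, q * r, rfl⟩, ?_⟩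
    simp only [LinearMap.mulLeft_apply]
    push_cast
    field_simp

/-- The ratio of two perpendicular vectors is purely imaginary. -/
theorem conj_div_of_perpendicular {b c : ℂ} (hb : b ≠ 0) (hc : c ≠ 0)
    (h : lineArg b = -lineArg c) : conj (c / b) = -(c / b) := by
  have hb' : conj b ≠ 0 := by simpa using hb
  have hc' : conj c ≠ 0 := by simpa using hc
  simp only [lineArg] at h
  rw [map_div₀]
  field_simp at h ⊢
  linear_combination h

/-- With the perpendicular lines as axes, `a` is proportional to `1 + τ` with `τ` imaginary, so
`-lineArg a / lineArg b = (τ + 1) / (τ - 1)`. The map `y ↦ (y + 1) / (y - 1)` is an involution. -/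
theorem inSecondFamily_of_perpendicular {V : Submodule ℚ ℂ} (hV : IsSpace V) {a b c : ℂ}
    (ha : a ∈ V) (hb : b ∈ V) (hc : c ∈ V) (ha0 : a ≠ 0) (hb0 : b ≠ 0) (hc0 : c ≠ 0)
    (hbc : lineArg b = -lineArg c) (hab : lineArg a ≠ lineArg b) (hac : lineArg a ≠ lineArg c)
    (hcomm : Commensurable a b) : ∃ W, InSecondFamily W ∧ Homothetic V W := by
  have hne : lineArg b ≠ lineArg c := by
    rw [hbc]
    intro h
    exact lineArg_ne_zero hc0 (by linear_combination -(1 / 2) * h)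
  have hspan := eq_span_pair hV hb hc hb0 hc0 hne
  obtain ⟨r, s, hrs⟩ := mem_span_pair_rat.1 (hspan ▸ ha)
  have hr : r ≠ 0 := by
    rintro rfl
    apply hac
    rw [lineArg_eq_iff ha0 hc0, ← hrs]
    simp
    ring
  have hs : s ≠ 0 := by
    rintro rfl
    apply hab
    rw [lineArg_eq_iff ha0 hb0, ← hrs]
    simp
    ring
  have hrC : (r : ℂ) ≠ 0 := by exact_mod_cast hr
  have hsC : (s : ℂ) ≠ 0 := by exact_mod_cast hs
  have hconj0 := conj_div_of_perpendicular hb0 hc0 hbc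
  set τ : ℂ := ((s / r : ℚ) : ℂ) * (c / b) with hτ
  have hτ0 : τ ≠ 0 := by
    rw [hτ]
    push_cast
    exact mul_ne_zero (div_ne_zero hsC hrC) (div_ne_zero hc0 hb0)
  have hconj : conj τ = -τ := by
    rw [hτ, map_mul, hconj0, map_ratCast, mul_neg]
  have h1 : τ - 1 ≠ 0 := by
    intro h
    have h1 : τ = 1 := by linear_combination h
    rw [h1] at hconj
    norm_num [map_one] at hconj
  have ha' : a = r * b * (1 + τ) := by
    rw [← hrs, hτ]
    push_cast
    field_simp
  have hb' : conj b ≠ 0 := by simpa using hb0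
  have hy : (τ + 1) / (τ - 1) = -1 * (lineArg a / lineArg b) := by
    have h1' : 1 - τ ≠ 0 := fun h => h1 (by linear_combination -h)
    have hca : conj a = r * conj b * (1 - τ) := by
      rw [ha', map_mul, map_mul, map_ratCast, map_add, map_one, hconj]
      ring
    simp only [lineArg, hca]
    rw [ha']
    field_simp
    ring
  refine ⟨spaceOf τ, ⟨(τ + 1) / (τ - 1), ?_, ?_, ?_, ?_⟩, ?_⟩
  · rw [hy]
    exact isRootOfUnity_neg_one.mul hcomm
  · intro h
    rw [div_eq_one_iff_eq h1] at h
    have : (2 : ℂ) = 0 := by linear_combination h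
    norm_num at this
  · intro h
    rw [div_eq_iff h1] at h
    exact hτ0 (by linear_combination (1 / 2) * h)
  · congr 1
    have : (τ + 1) / (τ - 1) - 1 = 2 / (τ - 1) := by field_simp; ring
    rw [this]
    field_simp
    ring
  · rw [hspan]
    exact homothetic_spaceOf hb0 (div_ne_zero hs hr)

theorem inFirstFamily_of_perpendicular {V : Submodule ℚ ℂ} (hV : IsSpace V) {b c l r : ℂ}
    (hb : b ∈ V) (hc : c ∈ V) (hb0 : b ≠ 0) (hc0 : c ≠ 0)
    (hl0 : l ≠ 0) (hr0 : r ≠ 0) (hbc : lineArg b = -lineArg c) {P₀ P₁ Q₀ Q₁ : ℚ}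
    (hP₀ : P₀ ≠ 0) (hP₁ : P₁ ≠ 0) (hQ₀ : Q₀ ≠ 0) (hQ₁ : Q₁ ≠ 0)
    (hl : l = P₀ * b + Q₀ * c) (hr : r = P₁ * b + Q₁ * c)
    (hd : P₀ * Q₁ - Q₀ * P₁ ≠ 0) (hs : P₀ * Q₁ + Q₀ * P₁ ≠ 0) (hlr : lineArg l ≠ lineArg r)
    (hcomm : Commensurable l r) : ∃ W, InFirstFamily W ∧ Homothetic V W := by
  have hne : lineArg b ≠ lineArg c := by
    rw [hbc]
    intro h
    exact lineArg_ne_zero hc0 (by linear_combination -(1 / 2) * h)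
  have hspan := eq_span_pair hV hb hc hb0 hc0 hne
  have hP₀C : (P₀ : ℂ) ≠ 0 := by exact_mod_cast hP₀
  have hP₁C : (P₁ : ℂ) ≠ 0 := by exact_mod_cast hP₁
  have hQ₀C : (Q₀ : ℂ) ≠ 0 := by exact_mod_cast hQ₀
  have hQ₁C : (Q₁ : ℂ) ≠ 0 := by exact_mod_cast hQ₁
  have hconj0 := conj_div_of_perpendicular hb0 hc0 hbc
  -- In units of `b`, `l` is proportional to `1 + τ` and `r` to `a + τ`. Here `a ≠ 1` expresses that
  -- the lines differ, and `a ≠ -1` that they are not harmonic to the axes.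
  set τ : ℂ := ((Q₀ / P₀ : ℚ) : ℂ) * (c / b) with hτ
  set a : ℚ := P₁ * Q₀ / (Q₁ * P₀) with ha
  have haC : (a : ℂ) = P₁ * Q₀ / (Q₁ * P₀) := by rw [ha]; push_cast; rfl
  have hconj : conj τ = -τ := by
    rw [hτ, map_mul, hconj0, map_ratCast, mul_neg]
  have hl' : l = P₀ * b * (1 + τ) := by
    rw [hl, hτ]
    push_cast
    field_simp
  have hr' : r = Q₁ * P₀ / Q₀ * b * (a + τ) := by
    rw [hr, hτ, haC]
    push_cast
    field_simp
  have hb' : conj b ≠ 0 := by simpa using hb0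
  have hlc : conj l = P₀ * conj b * (1 - τ) := by
    rw [hl', map_mul, map_mul, map_ratCast, map_add, map_one, hconj]
    ring
  have hrc : conj r = Q₁ * P₀ / Q₀ * conj b * (a - τ) := by
    rw [hr']
    simp only [map_mul, map_div₀, map_ratCast, map_add, hconj]
    ring
  have hl1 : 1 - τ ≠ 0 := by
    intro h
    rw [h, mul_zero] at hlc
    exact hl0 (by simpa using hlc)
  have hr1 : (a : ℂ) + τ ≠ 0 := by
    intro h
    rw [h, mul_zero] at hr'
    exact hr0 hr'
  have hr2 : (a : ℂ) - τ ≠ 0 := by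
    intro h
    rw [h, mul_zero] at hrc
    exact hr0 (by simpa using hrc)
  have hy1 : lineArg l / lineArg r ≠ 1 := by
    rw [Ne, div_eq_one_iff_eq (lineArg_ne_zero hr0)]
    exact hlr
  have hy : lineArg l / lineArg r * ((1 - τ) * (a + τ)) = (1 + τ) * (a - τ) := by
    simp only [lineArg, hlc, hrc]
    rw [hl', hr']
    field_simp
  set y := lineArg l / lineArg r
  have hy1' : y - 1 ≠ 0 := sub_ne_zero.2 hy1
  refine ⟨spaceOf τ, ⟨a, y, τ, ?_, ?_, ?_, hcomm, hy1, ?_, ?_, rfl⟩, ?_⟩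
  · exact div_ne_zero (mul_ne_zero hP₁ hQ₀) (mul_ne_zero hQ₁ hP₀)
  · intro h
    rw [ha, div_eq_one_iff_eq (mul_ne_zero hQ₁ hP₀)] at h
    exact hd (by linear_combination -h)
  · intro h
    rw [ha, div_eq_iff (mul_ne_zero hQ₁ hP₀)] at h
    exact hs (by linear_combination h)
  · have := congrArg Complex.re hconj
    simp only [Complex.conj_re, Complex.neg_re] at this
    linarith
  · field_simp
    linear_combination -hy
  · rw [hspan]
    exact homothetic_spaceOf hb0 (div_ne_zero hQ₀ hP₀)

end RationalAngles

/-! ### Four, five and six lines -/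

namespace RationalAngles

open ComplexConjugate

/-- The alternative of the main theorem for one rational angle: its order is bounded, or the space
belongs to one of the two families. -/
def BoundedOrFamily (V : Submodule ℚ ℂ) (v w : ℂ) : Prop :=
  (∃ m : ℕ, 0 < m ∧ m ≤ 48 * primorial 27 ∧ (lineArg v / lineArg w) ^ m = 1) ∨
    ∃ W, (InFirstFamily W ∨ InSecondFamily W) ∧ Homothetic V W

theorem bracket_ne_zero {e₁ e₂ u v : ℂ} {p q p' q' : ℚ} (hu : u = p * e₁ + q * e₂)
    (hv : v = p' * e₁ + q' * e₂) (hu0 : u ≠ 0) (hv0 : v ≠ 0) (hne : lineArg u ≠ lineArg v) :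
    p * q' - q * p' ≠ 0 := by
  intro h
  apply hne
  have hC : (p * q' - q * p' : ℂ) = 0 := by exact_mod_cast h
  rw [lineArg_eq_iff hu0 hv0, hu, hv]
  simp only [map_add, map_mul, map_ratCast]
  linear_combination (e₁ * conj e₂ - e₂ * conj e₁) * hC

theorem exists_coordinates {V : Submodule ℚ ℂ} (hV : IsSpace V) {e₁ e₂ : ℂ} (h₁ : e₁ ∈ V)
    (h₂ : e₂ ∈ V) (hne₁ : e₁ ≠ 0) (hne₂ : e₂ ≠ 0) (hne : lineArg e₁ ≠ lineArg e₂)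
    {ι : Type*} (u : ι → ℂ) (hu : ∀ i, u i ∈ V) :
    ∃ p q : ι → ℚ, ∀ i, u i = p i * e₁ + q i * e₂ := by
  have hspan := eq_span_pair hV h₁ h₂ hne₁ hne₂ hne
  have : ∀ i, ∃ p q : ℚ, (p : ℂ) * e₁ + q * e₂ = u i := fun i =>
    mem_span_pair_rat.1 (hspan ▸ hu i)
  choose p q h using this
  exact ⟨p, q, fun i => (h i).symm⟩

theorem degreeOf_six_term_le (b₁ b₂ b₃ : ℚ) (i : Fin 3) :
    (MvPolynomial.C b₁ * (MvPolynomial.X 0 + MvPolynomial.X 1 * MvPolynomial.X 2) +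
      MvPolynomial.C b₂ * (MvPolynomial.X 1 + MvPolynomial.X 0 * MvPolynomial.X 2) +
      MvPolynomial.C b₃ * (MvPolynomial.X 2 + MvPolynomial.X 0 * MvPolynomial.X 1) :
      MvPolynomial (Fin 3) ℚ).degreeOf i ≤ 2 := by
  have hX : ∀ j, (MvPolynomial.X j : MvPolynomial (Fin 3) ℚ).degreeOf i ≤ 1 := fun j => by
    rw [MvPolynomial.degreeOf_X]
    split_ifs <;> omega
  have hterm : ∀ (b : ℚ) (j k l : Fin 3), (MvPolynomial.C b * (MvPolynomial.X j +
      MvPolynomial.X k * MvPolynomial.X l) : MvPolynomial (Fin 3) ℚ).degreeOf i ≤ 2 := by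
    intro b j k l
    refine (MvPolynomial.degreeOf_mul_le _ _ _).trans ?_
    rw [MvPolynomial.degreeOf_C, zero_add]
    refine (MvPolynomial.degreeOf_add_le _ _ _).trans (max_le ((hX j).trans (by norm_num)) ?_)
    exact (MvPolynomial.degreeOf_mul_le _ _ _).trans (Nat.add_le_add (hX k) (hX l))
  exact (MvPolynomial.degreeOf_add_le _ _ _).trans (max_le
    ((MvPolynomial.degreeOf_add_le _ _ _).trans (max_le (hterm _ _ _ _) (hterm _ _ _ _)))
    (hterm _ _ _ _))

/-- Four commensurable lines. -/
theorem boundedOrFamily_of_four {V : Submodule ℚ ℂ} (hV : IsSpace V) {u : Fin 4 → ℂ}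
    (hu : ∀ i, u i ∈ V) (hu0 : ∀ i, u i ≠ 0) (hinj : Function.Injective fun i => lineArg (u i))
    (hcomm : ∀ i, Commensurable (u i) (u 0)) : BoundedOrFamily V (u 1) (u 0) := by
  obtain ⟨p, q, hpq⟩ := exists_coordinates hV (hu 0) (hu 1) (hu0 0) (hu0 1)
    (hinj.ne (by decide : (0 : Fin 4) ≠ 1)) u hu
  set e₁ := u 0
  set e₂ := u 1
  have hbr : ∀ i j, i ≠ j → p i * q j - q i * p j ≠ 0 := fun i j hij =>
    bracket_ne_zero (hpq i) (hpq j) (hu0 i) (hu0 j) (hinj.ne hij)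
  set y : Fin 4 → ℂ := fun i => lineArg (u i) / lineArg (u 0) with hy
  have hρ : ∀ i, lineArg (u i) ≠ 0 := fun i => lineArg_ne_zero (hu0 i)
  have hy0 : y 0 = 1 := div_self (hρ 0)
  have hyi : Function.Injective y := fun i j h => hinj ((div_left_inj' (hρ 0)).1 h)
  have hconj : ∀ i, conj (u i) = p i * conj e₁ + q i * conj e₂ := by
    intro i
    rw [hpq i]
    simp
  set P : MvPolynomial (Fin 3) ℚ :=
    MvPolynomial.C ((p 0 * q 1 - q 0 * p 1) * (p 2 * q 3 - q 2 * p 3)) *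
      (MvPolynomial.X 0 + MvPolynomial.X 1 * MvPolynomial.X 2) +
    MvPolynomial.C (-((p 0 * q 2 - q 0 * p 2) * (p 1 * q 3 - q 1 * p 3))) *
      (MvPolynomial.X 1 + MvPolynomial.X 0 * MvPolynomial.X 2) +
    MvPolynomial.C ((p 0 * q 3 - q 0 * p 3) * (p 1 * q 2 - q 1 * p 2)) *
      (MvPolynomial.X 2 + MvPolynomial.X 0 * MvPolynomial.X 1) with hP
  have hPev : ∀ Y : Fin 4 → ℂ, Y 0 = 1 → P.aeval (fun j : Fin 3 => Y j.succ) = quadDet p q Y := by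
    intro Y hY
    simp [hP, quadDet, hY]
    ring
  have h0 : P.aeval (fun j : Fin 3 => y j.succ) = 0 := by
    rw [hPev y hy0, ← hasCommonSolution_iff_quadDet]
    refine ⟨e₁, e₂, lineArg (u 0) * conj e₁, lineArg (u 0) * conj e₂, fun h => hu0 0 h.1,
      fun j => ?_⟩
    rw [← hpq j]
    calc u j = lineArg (u j) * conj (u j) := (lineArg_mul_conj (hu0 j)).symm
      _ = y j * lineArg (u 0) * conj (u j) := by rw [hy, div_mul_cancel₀ _ (hρ 0)]
      _ = _ := by rw [hconj j]; ring
  rcases exists_pow_eq_one_or_family P (degreeOf_six_term_le _ _ _) (fun j : Fin 3 => y j.succ)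
    (fun j => hcomm j.succ) h0 with h | ⟨α, hα, hfam⟩
  · exact Or.inl h
  right
  set k : Fin 4 → ℤ := Fin.cons 0 α with hk
  have hsol : ∀ t : ℂ, t ≠ 0 → HasCommonSolution p q fun j => y j * t ^ k j := by
    intro t ht
    rw [hasCommonSolution_iff_quadDet, ← hPev _ (by simp [hk, hy0]), ← hfam t ht]
    rfl
  set σ := Tuple.sort k
  have hm : Monotone (k ∘ σ) := Tuple.monotone_sort k
  obtain ⟨-, -, h12⟩ := exponents_of_four_lines (p := p ∘ σ) (q := q ∘ σ) (y := y ∘ σ)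
    (k := k ∘ σ) (fun i j hij => hbr _ _ (σ.injective.ne hij))
    (fun i => div_ne_zero (hρ _) (hρ 0)) (hyi.comp σ.injective) hm
    (fun t ht => (hsol t ht).comp σ)
  have hne : (k ∘ σ) 0 ≠ (k ∘ σ) 3 := by
    intro h03
    have hall : ∀ i, k i = (k ∘ σ) 0 := by
      intro i
      have h1 := hm (Fin.zero_le (σ.symm i))
      have h2 := hm (Fin.le_last (σ.symm i))
      simp only [Function.comp_apply, Equiv.apply_symm_apply] at h1 h2 h03 ⊢
      have h3 : k (σ (Fin.last 3)) = k (σ 3) := rfl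
      omega
    have h1 := hall 0
    have h2 := hall 1
    rw [← h1] at h2
    exact hα h2
  have hperp : lineArg (u (σ 1)) = - lineArg (u (σ 2)) := by
    have := h12 hne
    simp only [Function.comp_apply, hy] at this
    rw [← neg_div, div_left_inj' (hρ 0)] at this
    exact this
  obtain ⟨W, hW, hVW⟩ := inSecondFamily_of_perpendicular hV (hu (σ 0)) (hu (σ 1)) (hu (σ 2))
    (hu0 _) (hu0 _) (hu0 _) hperp (hinj.ne (σ.injective.ne (by decide)))
    (hinj.ne (σ.injective.ne (by decide)))
    ((hcomm (σ 0)).trans (hu0 0) (hcomm (σ 1)).symm)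
  exact ⟨W, Or.inr hW, hVW⟩

theorem angle_equation {e₁ e₂ u v : ℂ} {p q p' q' : ℚ} (hu : u = p * e₁ + q * e₂)
    (hv : v = p' * e₁ + q' * e₂) (hu0 : u ≠ 0) (hv0 : v ≠ 0) :
    (p * e₁ + q * e₂) * (p' * conj e₁ + q' * conj e₂) =
      lineArg u / lineArg v * ((p' * e₁ + q' * e₂) * (p * conj e₁ + q * conj e₂)) := by
  have hu' : (p * conj e₁ + q * conj e₂ : ℂ) = conj u := by rw [hu]; simp
  have hv' : (p' * conj e₁ + q' * conj e₂ : ℂ) = conj v := by rw [hv]; simp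
  have h1 : conj u ≠ 0 := by simpa using hu0
  have h2 : conj v ≠ 0 := by simpa using hv0
  rw [hu', hv', ← hu, ← hv, lineArg, lineArg]
  field_simp

/-- Three pairs of lines with independent quadratic forms, comprising at least five lines. -/
theorem boundedOrFamily_of_det_ne_zero {V : Submodule ℚ ℂ}
    {u : Fin 3 → Fin 2 → ℂ} (hu0 : ∀ j s, u j s ≠ 0)
    (hcomm : ∀ j, Commensurable (u j 0) (u j 1)) (hne : ∀ j, lineArg (u j 0) ≠ lineArg (u j 1))
    {e₁ e₂ : ℂ} (he₁ : e₁ ≠ 0) (he₂ : e₂ ≠ 0) (he : lineArg e₁ ≠ lineArg e₂)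
    {p q : Fin 3 → Fin 2 → ℚ} (hpq : ∀ j s, u j s = p j s * e₁ + q j s * e₂)
    (hdet : (pairMatrix p q).det ≠ 0)
    (f : Fin 5 → Fin 3 × Fin 2) (hf0 : f 0 = (0, 0)) (hf1 : f 1 = (0, 1))
    (hf : Function.Injective fun i => lineArg (u (f i).1 (f i).2)) :
    BoundedOrFamily V (u 0 0) (u 0 1) := by
  left
  refine pow_eq_one_of_det_ne_zero (x := fun j => lineArg (u j 0) / lineArg (u j 1))
    (T₀ := e₁) (W₀ := e₂) (S₀ := conj e₁) (R₀ := conj e₂)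
    (fun j => bracket_ne_zero (hpq j 0) (hpq j 1) (hu0 j 0) (hu0 j 1) (hne j)) hdet hcomm ?_ he₁
    (by simpa using he₁) (fun j s => by rw [← hpq]; exact hu0 j s) (fun j s => ?_)
    (fun j => angle_equation (hpq j 0) (hpq j 1) (hu0 j 0) (hu0 j 1)) f hf0 hf1
    (fun i j hij => bracket_ne_zero (hpq _ _) (hpq _ _) (hu0 _ _) (hu0 _ _) (hf.ne hij))
  · rw [Ne, lineArg_eq_iff he₁ he₂] at he
    exact sub_ne_zero.2 he
  · have : (p j s * conj e₁ + q j s * conj e₂ : ℂ) = conj (u j s) := by rw [hpq]; simp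
    rw [this]
    simpa using hu0 j s

theorem boundedOrFamily_of_five {V : Submodule ℚ ℂ} (hV : IsSpace V)
    {u : Fin 3 → Fin 2 → ℂ} (hu : ∀ j s, u j s ∈ V) (hu0 : ∀ j s, u j s ≠ 0)
    (hcomm : ∀ j, Commensurable (u j 0) (u j 1)) {i j k : Fin 3} (hij : i ≠ j) (hik : i ≠ k)
    (hjk : j ≠ k) (huij : u i 0 = u j 0)
    (f : Fin 5 → Fin 3 × Fin 2) (hf0 : f 0 = (0, 0)) (hf1 : f 1 = (0, 1))
    (hf : Function.Injective fun i => lineArg (u (f i).1 (f i).2))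
    (hki : ∀ s, lineArg (u k s) ≠ lineArg (u i 0))
    (hr : lineArg (u i 1) ≠ lineArg (u j 1))
    (hne : ∀ j, lineArg (u j 0) ≠ lineArg (u j 1)) :
    BoundedOrFamily V (u 0 0) (u 0 1) := by
  obtain ⟨p', q', hpq'⟩ := exists_coordinates hV (hu 0 0) (hu 0 1) (hu0 0 0) (hu0 0 1) (hne 0)
    (fun a : Fin 3 × Fin 2 => u a.1 a.2) (fun a => hu _ _)
  -- The shared vector gets the same coordinates at both of its positions by construction.
  set p : Fin 3 → Fin 2 → ℚ := fun a s => if (a, s) = (j, 0) then p' (i, 0) else p' (a, s) with hp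
  set q : Fin 3 → Fin 2 → ℚ := fun a s => if (a, s) = (j, 0) then q' (i, 0) else q' (a, s) with hq
  have hpq : ∀ a s, u a s = p a s * u 0 0 + q a s * u 0 1 := by
    intro a s
    by_cases h : (a, s) = (j, 0)
    · have h1 := hpq' (i, 0)
      simp only [hp, hq, if_pos h]
      rw [Prod.mk.injEq] at h
      rw [h.1, h.2, ← huij]
      exact h1
    · simp only [hp, hq, if_neg h]
      exact hpq' (a, s)
  have hb : ∀ a b s t, lineArg (u a s) ≠ lineArg (u b t) →
      p a s * q b t - q a s * p b t ≠ 0 := fun a b s t h =>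
    bracket_ne_zero (hpq a s) (hpq b t) (hu0 a s) (hu0 b t) h
  refine boundedOrFamily_of_det_ne_zero hu0 hcomm hne (hu0 0 0) (hu0 0 1) (hne 0) hpq ?_ f hf0 hf1 hf
  refine pairMatrix_det_ne_zero_of_common hij hik hjk ?_ ?_ (fun s => hb _ _ _ _ (hki s))
    (hb _ _ _ _ (hne i)) (hb _ _ _ _ (hne j)) (hb _ _ _ _ hr)
  · simp [hp]
  · simp [hq]

/-- Three disjoint pairs of commensurable lines. -/
theorem boundedOrFamily_of_six {V : Submodule ℚ ℂ} (hV : IsSpace V)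
    {u : Fin 3 → Fin 2 → ℂ} (hu : ∀ j s, u j s ∈ V) (hu0 : ∀ j s, u j s ≠ 0)
    (hcomm : ∀ j, Commensurable (u j 0) (u j 1))
    (hinj : Function.Injective fun a : Fin 3 × Fin 2 => lineArg (u a.1 a.2)) :
    BoundedOrFamily V (u 0 0) (u 0 1) := by
  have hneq : ∀ a b s t, (a, s) ≠ (b, t) → lineArg (u a s) ≠ lineArg (u b t) := fun a b s t h =>
    hinj.ne h
  have hne : ∀ j, lineArg (u j 0) ≠ lineArg (u j 1) := fun j => hneq _ _ _ _ (by simp)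
  obtain ⟨p', q', hpq'⟩ := exists_coordinates hV (hu 0 0) (hu 0 1) (hu0 0 0) (hu0 0 1) (hne 0)
    (fun a : Fin 3 × Fin 2 => u a.1 a.2) (fun a => hu _ _)
  set p : Fin 3 → Fin 2 → ℚ := fun a s => p' (a, s)
  set q : Fin 3 → Fin 2 → ℚ := fun a s => q' (a, s)
  have hpq : ∀ a s, u a s = p a s * u 0 0 + q a s * u 0 1 := fun a s => hpq' (a, s)
  by_cases hdet : (pairMatrix p q).det = 0
  swap
  · exact boundedOrFamily_of_det_ne_zero hu0 hcomm hne (hu0 0 0) (hu0 0 1) (hne 0) hpq hdet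
      ![(0, 0), (0, 1), (1, 0), (1, 1), (2, 0)] rfl rfl (hinj.comp (by decide))
  have hbr : ∀ a b : Fin 3 × Fin 2, a ≠ b → p a.1 a.2 * q b.1 b.2 - q a.1 a.2 * p b.1 b.2 ≠ 0 :=
    fun a b hab => bracket_ne_zero (hpq _ _) (hpq _ _) (hu0 _ _) (hu0 _ _) (hinj.ne hab)
  obtain ⟨c, hc0, hc⟩ := Matrix.exists_vecMul_eq_zero_iff.2 hdet
  set d : Fin 3 → ℚ := fun j => p j 0 * q j 1 - q j 0 * p j 1 with hd
  have hcj := coeff_ne_zero_of_vecMul_pairMatrix hbr hc0 hc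
  have hsign := signed_sum_coeff_mul_bracket_ne_zero hbr hc0 hc
  set x : Fin 3 → ℂ := fun j => lineArg (u j 0) / lineArg (u j 1) with hx
  set e₁ := u 0 0 with he₁
  set e₂ := u 0 1 with he₂
  have hδ : e₁ * conj e₂ - e₂ * conj e₁ ≠ 0 := by
    have := hne 0
    rw [Ne, lineArg_eq_iff (hu0 0 0) (hu0 0 1)] at this
    exact sub_ne_zero.2 this
  set P : MvPolynomial (Fin 3) ℚ := cotForm (fun j => MvPolynomial.C (c j * d j))
    (fun j => 1 + MvPolynomial.X j) (fun j => 1 - MvPolynomial.X j) with hP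
  have hPev : ∀ z : Fin 3 → ℂ, P.aeval z = cotNum (fun j => ((c j * d j : ℚ) : ℂ)) z := by
    intro z
    simp [hP, cotForm, cotNum]
  -- Each angle equation gives `d j * (1 + x j) / (1 - x j)` as a common factor times the `j`-th
  -- quadratic form at the base point; the dependency `c` makes the weighted sum vanish.
  have hP0 : P.aeval x = 0 := by
    rw [hPev]
    have ang := fun j => angle_equation (hpq j 0) (hpq j 1) (hu0 j 0) (hu0 j 1)
    have a0 := ang 0
    have a1 := ang 1
    have a2 := ang 2
    have h0 := congrArg (fun r : ℚ => (r : ℂ)) (congrFun hc 0)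
    have h1 := congrArg (fun r : ℚ => (r : ℂ)) (congrFun hc 1)
    have h2 := congrArg (fun r : ℚ => (r : ℂ)) (congrFun hc 2)
    simp [Matrix.vecMul, dotProduct, Fin.sum_univ_three, pairMatrix] at h0 h1 h2
    apply (mul_eq_zero.1 (?_ : (e₁ * conj e₂ - e₂ * conj e₁) * _ = 0)).resolve_left hδ
    simp only [cotNum, hd]
    change _ = x 0 * _ at a0
    change _ = x 1 * _ at a1
    change _ = x 2 * _ at a2
    push_cast
    clear_value x p q e₁ e₂
    linear_combination
      2 * c 0 * ((1 - x 1) * (1 - x 2)) * a0 + 2 * c 1 * ((1 - x 0) * (1 - x 2)) * a1 +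
      2 * c 2 * ((1 - x 0) * (1 - x 1)) * a2 -
      (1 - x 0) * (1 - x 1) * (1 - x 2) * (2 * (e₁ * conj e₁) * h0 +
        (e₁ * conj e₂ + e₂ * conj e₁) * h1 + 2 * (e₂ * conj e₂) * h2)
  rcases exists_pow_eq_one_or_family P (fun i => (degreeOf_cotForm_le _ i).trans (by norm_num)) x
    hcomm hP0 with h | ⟨α, hα, hfam⟩
  · exact Or.inl h
  right
  have hdj : ∀ j, d j ≠ 0 := fun j => hbr (j, 0) (j, 1) (by simp)
  obtain ⟨σ, hσ, hβ⟩ := cot_family (β := fun j => ((c j * d j : ℚ) : ℂ)) (x := x)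
    (fun ε h => hsign ε (by exact_mod_cast h))
    (fun j => by exact_mod_cast mul_ne_zero (hcj j) (hdj j))
    (fun j => div_ne_zero (lineArg_ne_zero (hu0 _ _)) (lineArg_ne_zero (hu0 _ _)))
    (fun j => by
      simp only [hx]
      rw [Ne, div_eq_one_iff_eq (lineArg_ne_zero (hu0 _ _))]
      exact hne j) (α := α) (fun h => hα (by rw [h]; rfl)) (fun t ht => by rw [← hPev]; exact hfam t ht)
  have hAB : σ 0 ≠ σ 1 := σ.injective.ne (by decide)
  have hAC : σ 0 ≠ σ 2 := σ.injective.ne (by decide)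
  have hBC : σ 1 ≠ σ 2 := σ.injective.ne (by decide)
  generalize σ 0 = A, σ 1 = B, σ 2 = C at *
  have hperp : lineArg (u A 0) = -lineArg (u A 1) := by
    simp only [hx] at hσ
    rw [div_eq_iff (lineArg_ne_zero (hu0 A 1))] at hσ
    linear_combination hσ
  have hβ' : c B * d B = c C * d C ∨ c B * d B = -(c C * d C) := by exact_mod_cast hβ
  have hsum := sum_brackets_eq_zero hc
  simp only [Fin.univ_three_eq hAB hAC hBC,
    Finset.sum_insert (show A ∉ ({B, C} : Finset (Fin 3)) by simp [hAB, hAC]),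
    Finset.sum_insert (show B ∉ ({C} : Finset (Fin 3)) by simp [hBC]), Finset.sum_singleton] at hsum
  have s₁ := hsum (p A 1) (q A 1)
  have s₂ := hsum (p A 0) (q A 0)
  have hdC : (d A : ℂ) ≠ 0 := by exact_mod_cast hdj A
  -- coordinates with respect to the perpendicular pair
  set X : Fin 3 → Fin 2 → ℚ := fun j s => p j s * q A 1 - q j s * p A 1 with hX
  set Y : Fin 3 → Fin 2 → ℚ := fun j s => p A 0 * q j s - q A 0 * p j s with hY
  have hX0 : ∀ j s, A ≠ j → X j s ≠ 0 := fun j s h => hbr (j, s) (A, 1) (by simp [h.symm])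
  have hY0 : ∀ j s, A ≠ j → Y j s ≠ 0 := fun j s h => hbr (A, 0) (j, s) (by simp [h])
  have hXY : ∀ a b : Fin 3 × Fin 2, X a.1 a.2 * Y b.1 b.2 - Y a.1 a.2 * X b.1 b.2 =
      d A * (p a.1 a.2 * q b.1 b.2 - q a.1 a.2 * p b.1 b.2) := by
    intro a b
    simp only [hX, hY, hd]
    ring
  have hcoord : ∀ j s, u j s = ((X j s / d A : ℚ) : ℂ) * u A 0 + ((Y j s / d A : ℚ) : ℂ) * u A 1 := by
    intro j s
    push_cast
    field_simp
    rw [hpq j s, hpq A 0, hpq A 1]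
    simp only [hX, hY, hd]
    push_cast
    ring
  -- The equality `c B * d B = ± c C * d C` supplies the third equation of
  -- `not_harmonic_of_dependent`; for the plus sign the lines of pair `C` are exchanged.
  have hharm : X B 0 * Y B 1 + Y B 0 * X B 1 ≠ 0 := by
    have h₁ : c B * (X B 0 * X B 1) + c C * (X C 0 * X C 1) = 0 := by
      simp only [hX]
      linear_combination s₁
    have h₂ : c B * (Y B 0 * Y B 1) + c C * (Y C 0 * Y C 1) = 0 := by
      simp only [hY]
      linear_combination s₂
    have eB : X B 0 * Y B 1 - Y B 0 * X B 1 = d A * d B := hXY (B, 0) (B, 1)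
    have eC : X C 0 * Y C 1 - Y C 0 * X C 1 = d A * d C := hXY (C, 0) (C, 1)
    rcases hβ' with h | h
    · refine not_harmonic_of_dependent (hcj B) (hY0 B 0 hAB) (hY0 B 1 hAB)
        (?_ : _ = (0 : ℚ)) (?_ : _ = (0 : ℚ)) ?_
        (p₀ := X C 1) (p₁ := X C 0) (q₀ := Y C 1) (q₁ := Y C 0) (c := c C) ?_
      · linear_combination h₁
      · linear_combination h₂
      · linear_combination c B * eB - c C * eC + d A * h
      · rw [hXY (B, 0) (C, 1)]
        exact mul_ne_zero (hdj A) (hbr (B, 0) (C, 1) (by simp))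
    · refine not_harmonic_of_dependent (hcj B) (hY0 B 0 hAB) (hY0 B 1 hAB) h₁ h₂ ?_ ?_
      · linear_combination c B * eB + c C * eC + d A * h
      · rw [hXY (B, 0) (C, 0)]
        exact mul_ne_zero (hdj A) (hbr (B, 0) (C, 0) (by simp [hBC]))
  obtain ⟨W, hW, hVW⟩ := inFirstFamily_of_perpendicular hV (hu A 0) (hu A 1) (hu0 A 0) (hu0 A 1)
    (hu0 B 0) (hu0 B 1) hperp (div_ne_zero (hX0 B 0 hAB) (hdj A))
    (div_ne_zero (hX0 B 1 hAB) (hdj A)) (div_ne_zero (hY0 B 0 hAB) (hdj A))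
    (div_ne_zero (hY0 B 1 hAB) (hdj A)) (hcoord B 0) (hcoord B 1)
    (by
      rw [div_mul_div_comm, div_mul_div_comm, ← sub_div, hXY (B, 0) (B, 1)]
      exact div_ne_zero (mul_ne_zero (hdj A) (hdj B)) (mul_ne_zero (hdj A) (hdj A)))
    (by
      rw [div_mul_div_comm, div_mul_div_comm, ← add_div]
      exact div_ne_zero hharm (mul_ne_zero (hdj A) (hdj A)))
    (hne B) (hcomm B)
  exact ⟨W, Or.inl hW, hVW⟩

end RationalAngles

/-! ### Adjoining an arbitrary rational angle to the given tuples -/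

namespace RationalAngles

theorem IsRationalTuple.ne_zero {V : Submodule ℚ ℂ} {n : ℕ} [Nontrivial (Fin n)] {t : Fin n → ℂ}
    (h : IsRationalTuple V t) (i : Fin n) : t i ≠ 0 := by
  obtain ⟨j, hj⟩ := exists_ne i
  exact (h.2 i j hj.symm).1

theorem IsRationalTuple.injective {V : Submodule ℚ ℂ} {n : ℕ} {t : Fin n → ℂ}
    (h : IsRationalTuple V t) : Function.Injective fun i => lineArg (t i) := by
  intro i j hij
  by_contra hne
  exact (h.2 i j hne).lineArg_ne hij

theorem DisjointTuples.lineArg_ne {n m : ℕ} {t : Fin n → ℂ} {t' : Fin m → ℂ}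
    (h : DisjointTuples t t') {i : Fin n} {j : Fin m} (hi : t i ≠ 0) (hj : t' j ≠ 0) :
    lineArg (t i) ≠ lineArg (t' j) := fun he => h i j (span_eq_of_lineArg_eq hi hj he)

theorem commensurable_of_lineArg_eq {v w : ℂ} (hw : w ≠ 0) (h : lineArg v = lineArg w) :
    Commensurable v w :=
  ⟨1, one_pos, by rw [h, div_self (lineArg_ne_zero hw), one_pow]⟩

theorem lineArg_ne_of_not_commensurable {u v : ℂ} (hv : v ≠ 0) (h : ¬ Commensurable u v) :
    lineArg u ≠ lineArg v := fun he => h (commensurable_of_lineArg_eq hv he)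

theorem exists_pair_avoiding {g : Fin 4 → ℂ} (hg : Function.Injective g) (a b : ℂ) :
    ∃ i j, i ≠ j ∧ g i ≠ a ∧ g i ≠ b ∧ g j ≠ a ∧ g j ≠ b := by
  have h1 : 1 < ((Finset.univ.image g) \ {a, b}).card := by
    have h2 := Finset.le_card_sdiff ({a, b} : Finset ℂ) (Finset.univ.image g)
    rw [Finset.card_image_of_injective _ hg, Finset.card_univ, Fintype.card_fin] at h2
    have h3 := Finset.card_le_two (a := a) (b := b)
    omega
  obtain ⟨x, hx, y, hy, hxy⟩ := Finset.one_lt_card.1 h1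
  simp only [Finset.mem_sdiff, Finset.mem_image, Finset.mem_univ, true_and, Finset.mem_insert,
    Finset.mem_singleton, not_or] at hx hy
  obtain ⟨⟨i, rfl⟩, hi⟩ := hx
  obtain ⟨⟨j, rfl⟩, hj⟩ := hy
  exact ⟨i, j, fun h => hxy (by rw [h]), hi.1, hi.2, hj.1, hj.2⟩

theorem exists_avoiding {g : Fin 3 → ℂ} (hg : Function.Injective g) (a b : ℂ) :
    ∃ i, g i ≠ a ∧ g i ≠ b := by
  by_contra! h
  have h01 := hg.ne (by decide : (0 : Fin 3) ≠ 1)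
  have h02 := hg.ne (by decide : (0 : Fin 3) ≠ 2)
  have h12 := hg.ne (by decide : (1 : Fin 3) ≠ 2)
  have h0 := h 0
  have h1 := h 1
  have h2 := h 2
  by_cases e0 : g 0 = a <;> by_cases e1 : g 1 = a <;> by_cases e2 : g 2 = a <;> simp_all

section Configurations

variable {V : Submodule ℚ ℂ} {v w : ℂ}

theorem boundedOrFamily_of_commensurable (hV : IsSpace V) (hv : v ∈ V) (hw : w ∈ V)
    (hvw : IsRationalAngle v w) {t : Fin 4 → ℂ} (ht : ∀ i, t i ∈ V) (ht0 : ∀ i, t i ≠ 0)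
    (hinj : Function.Injective fun i => lineArg (t i)) (hcomm : ∀ i, Commensurable (t i) v) :
    BoundedOrFamily V v w := by
  obtain ⟨i, j, hij, hi, hi', hj, hj'⟩ := exists_pair_avoiding hinj (lineArg v) (lineArg w)
  have hne := hvw.lineArg_ne
  have hcw := hvw.commensurable
  have hij' : lineArg (t i) ≠ lineArg (t j) := hinj.ne hij
  -- `w` comes first because the conclusion concerns the pair `(u 1, u 0)`. The lines of `v` and `w`
  -- may occur in `t`, so two others were selected.
  refine boundedOrFamily_of_four hV (u := ![w, v, t i, t j]) ?_ ?_ ?_ ?_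
  · intro l; fin_cases l
    exacts [hw, hv, ht i, ht j]
  · intro l; fin_cases l
    exacts [hvw.2.1, hvw.1, ht0 i, ht0 j]
  · intro l l' h
    fin_cases l <;> fin_cases l' <;> simp_all [eq_comm]
  · intro l; fin_cases l
    exacts [commensurable_of_lineArg_eq hvw.2.1 rfl, hcw, (hcomm i).trans hvw.1 hcw,
      (hcomm j).trans hvw.1 hcw]

theorem boundedOrFamily_of_not_commensurable (hV : IsSpace V) (hv : v ∈ V) (hw : w ∈ V)
    (hvw : IsRationalAngle v w) {t : Fin 4 → ℂ} (ht : ∀ i, t i ∈ V) (ht0 : ∀ i, t i ≠ 0)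
    (hinj : Function.Injective fun i => lineArg (t i)) (h01 : Commensurable (t 0) (t 1))
    (h23 : Commensurable (t 2) (t 3)) (hcomm : ∀ i, ¬ Commensurable (t i) v) :
    BoundedOrFamily V v w := by
  have hne := hvw.lineArg_ne
  have hcw := hvw.commensurable
  have htv : ∀ i, lineArg (t i) ≠ lineArg v := fun i =>
    lineArg_ne_of_not_commensurable hvw.1 (hcomm i)
  have htw : ∀ i, lineArg (t i) ≠ lineArg w := fun i =>
    lineArg_ne_of_not_commensurable hvw.2.1 fun h => hcomm i (h.trans hvw.2.1 hcw.symm)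
  refine boundedOrFamily_of_six hV (u := ![![v, w], ![t 0, t 1], ![t 2, t 3]]) ?_ ?_ ?_ ?_
  · intro l s; fin_cases l <;> fin_cases s
    exacts [hv, hw, ht 0, ht 1, ht 2, ht 3]
  · intro l s; fin_cases l <;> fin_cases s
    exacts [hvw.1, hvw.2.1, ht0 0, ht0 1, ht0 2, ht0 3]
  · intro l; fin_cases l
    exacts [hcw, h01, h23]
  · have hcons : Function.Injective
        (Fin.cons (lineArg v) (Fin.cons (lineArg w) fun i => lineArg (t i)) : Fin 6 → ℂ) := by
      rw [Fin.cons_injective_iff, Fin.cons_injective_iff]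
      refine ⟨?_, ?_, hinj⟩
      · rintro ⟨i, hi⟩
        refine Fin.cases (fun h => hne (by simpa using h.symm))
          (fun j h => htv j (by simpa using h)) i hi
      · rintro ⟨i, hi⟩
        exact htw i hi
    have e : (fun a : Fin 3 × Fin 2 => lineArg (![![v, w], ![t 0, t 1], ![t 2, t 3]] a.1 a.2)) =
        (Fin.cons (lineArg v) (Fin.cons (lineArg w) fun i => lineArg (t i)) : Fin 6 → ℂ) ∘
          (finProdFinEquiv : Fin 3 × Fin 2 ≃ Fin (3 * 2)) := by
      ext ⟨a, s⟩
      fin_cases a <;> fin_cases s <;> rfl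
    rw [e]
    exact hcons.comp (finProdFinEquiv : Fin 3 × Fin 2 ≃ Fin (3 * 2)).injective

theorem boundedOrFamily_of_quadruple (hV : IsSpace V) (hv : v ∈ V) (hw : w ∈ V)
    (hvw : IsRationalAngle v w) {t : Fin 4 → ℂ} (ht : IsRationalTuple V t) :
    BoundedOrFamily V v w := by
  have hc : ∀ i, Commensurable (t i) (t 0) := by
    intro i
    by_cases h : i = 0
    · rw [h]; exact commensurable_of_lineArg_eq (ht.ne_zero 0) rfl
    · exact (ht.2 i 0 h).commensurable
  by_cases h : Commensurable (t 0) v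
  · exact boundedOrFamily_of_commensurable hV hv hw hvw ht.1 ht.ne_zero ht.injective
      fun i => (hc i).trans (ht.ne_zero 0) h
  · exact boundedOrFamily_of_not_commensurable hV hv hw hvw ht.1 ht.ne_zero ht.injective
      (hc 1).symm ((hc 2).trans (ht.ne_zero 0) (hc 3).symm)
      fun i hi => h ((hc i).symm.trans (ht.ne_zero i) hi)

/-- Both tuples commensurable with `v`: four commensurable lines. Only the triple: `(v, w)` and `(v,
t i)` share a line and `t'` is the third pair. Triple not commensurable with `v`: it provides two
pairs sharing `t 0`, and `t'` plays no role. -/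
theorem boundedOrFamily_of_triple_and_pair (hV : IsSpace V) (hv : v ∈ V) (hw : w ∈ V)
    (hvw : IsRationalAngle v w) {t : Fin 3 → ℂ} {t' : Fin 2 → ℂ} (ht : IsRationalTuple V t)
    (ht' : IsRationalTuple V t') (hd : DisjointTuples t t') : BoundedOrFamily V v w := by
  have hne := hvw.lineArg_ne
  have hcw := hvw.commensurable
  have hc : ∀ i, Commensurable (t i) (t 0) := by
    intro i
    by_cases h : i = 0
    · rw [h]; exact commensurable_of_lineArg_eq (ht.ne_zero 0) rfl
    · exact (ht.2 i 0 h).commensurable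
  have hc' : Commensurable (t' 0) (t' 1) := (ht'.2 0 1 (by decide)).commensurable
  have hd' : ∀ i j, lineArg (t i) ≠ lineArg (t' j) := fun i j =>
    hd.lineArg_ne (ht.ne_zero i) (ht'.ne_zero j)
  by_cases h : Commensurable (t 0) v
  · by_cases h' : Commensurable (t' 0) v
    · refine boundedOrFamily_of_commensurable hV hv hw hvw (t := ![t 0, t 1, t 2, t' 0]) ?_ ?_ ?_ ?_
      · intro l; fin_cases l
        exacts [ht.1 0, ht.1 1, ht.1 2, ht'.1 0]
      · intro l; fin_cases l
        exacts [ht.ne_zero 0, ht.ne_zero 1, ht.ne_zero 2, ht'.ne_zero 0]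
      · have e01 : lineArg (t 0) ≠ lineArg (t 1) := ht.injective.ne (by decide)
        have e02 : lineArg (t 0) ≠ lineArg (t 2) := ht.injective.ne (by decide)
        have e12 : lineArg (t 1) ≠ lineArg (t 2) := ht.injective.ne (by decide)
        have e0 := hd' 0 0
        have e1 := hd' 1 0
        have e2 := hd' 2 0
        intro l l' hl
        fin_cases l <;> fin_cases l' <;> simp_all [eq_comm]
      · intro l; fin_cases l
        exacts [h, (hc 1).trans (ht.ne_zero 0) h, (hc 2).trans (ht.ne_zero 0) h, h']
    · obtain ⟨i, hi, hi'⟩ := exists_avoiding ht.injective (lineArg v) (lineArg w)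
      have hiv : Commensurable v (t i) := ((hc i).trans (ht.ne_zero 0) h).symm
      have h1 : ¬ Commensurable (t' 1) v := fun h1 => h' (hc'.trans (ht'.ne_zero 1) h1)
      have hnv : ∀ j, ¬ Commensurable (t' j) v := Fin.forall_fin_two.2 ⟨h', h1⟩
      have e1 : ∀ j, lineArg (t' j) ≠ lineArg v := fun j =>
        lineArg_ne_of_not_commensurable hvw.1 (hnv j)
      have e2 : ∀ j, lineArg (t' j) ≠ lineArg w := fun j =>
        lineArg_ne_of_not_commensurable hvw.2.1 fun h => hnv j (h.trans hvw.2.1 hcw.symm)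
      have e3 : lineArg (t' 0) ≠ lineArg (t' 1) := ht'.injective.ne (by decide)
      have e4 := hd' i
      refine boundedOrFamily_of_five hV (u := ![![v, w], ![v, t i], ![t' 0, t' 1]])
        ?_ ?_ ?_ (i := 0) (j := 1) (k := 2) (by decide) (by decide) (by decide) rfl
        ![(0, 0), (0, 1), (1, 1), (2, 0), (2, 1)] rfl rfl ?_ ?_ ?_ ?_
      · intro l s; fin_cases l <;> fin_cases s
        exacts [hv, hw, hv, ht.1 i, ht'.1 0, ht'.1 1]
      · intro l s; fin_cases l <;> fin_cases s
        exacts [hvw.1, hvw.2.1, hvw.1, ht.ne_zero i, ht'.ne_zero 0, ht'.ne_zero 1]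
      · intro l; fin_cases l
        exacts [hcw, hiv, hc']
      · have a0 := e1 0
        have a1 := e1 1
        have b0 := e2 0
        have b1 := e2 1
        have c0 := e4 0
        have c1 := e4 1
        intro l l' hl
        fin_cases l <;> fin_cases l' <;> simp_all [eq_comm]
      · intro s; fin_cases s
        exacts [e1 0, e1 1]
      · exact hi'.symm
      · intro l; fin_cases l
        exacts [hne, hi.symm, e3]
  · have hnv : ∀ j, ¬ Commensurable (t j) v := fun j hj => h ((hc j).symm.trans (ht.ne_zero j) hj)
    have e1 : ∀ j, lineArg (t j) ≠ lineArg v := fun j =>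
      lineArg_ne_of_not_commensurable hvw.1 (hnv j)
    have e2 : ∀ j, lineArg (t j) ≠ lineArg w := fun j =>
      lineArg_ne_of_not_commensurable hvw.2.1 fun h => hnv j (h.trans hvw.2.1 hcw.symm)
    have e01 : lineArg (t 0) ≠ lineArg (t 1) := ht.injective.ne (by decide)
    have e02 : lineArg (t 0) ≠ lineArg (t 2) := ht.injective.ne (by decide)
    have e12 : lineArg (t 1) ≠ lineArg (t 2) := ht.injective.ne (by decide)
    refine boundedOrFamily_of_five hV (u := ![![v, w], ![t 0, t 1], ![t 0, t 2]])
      ?_ ?_ ?_ (i := 1) (j := 2) (k := 0) (by decide) (by decide) (by decide) rfl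
      ![(0, 0), (0, 1), (1, 0), (1, 1), (2, 1)] rfl rfl ?_ ?_ ?_ ?_
    · intro l s; fin_cases l <;> fin_cases s
      exacts [hv, hw, ht.1 0, ht.1 1, ht.1 0, ht.1 2]
    · intro l s; fin_cases l <;> fin_cases s
      exacts [hvw.1, hvw.2.1, ht.ne_zero 0, ht.ne_zero 1, ht.ne_zero 0, ht.ne_zero 2]
    · intro l; fin_cases l
      exacts [hcw, (hc 1).symm, (hc 2).symm]
    · have a0 := e1 0
      have a1 := e1 1
      have a2 := e1 2
      have b0 := e2 0
      have b1 := e2 1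
      have b2 := e2 2
      intro l l' hl
      fin_cases l <;> fin_cases l' <;> simp_all [eq_comm]
    · intro s; fin_cases s
      exacts [(e1 0).symm, (e2 0).symm]
    · exact e12
    · intro l; fin_cases l
      exacts [hne, e01, e02]

theorem boundedOrFamily_of_two_pairs (hV : IsSpace V) (hv : v ∈ V) (hw : w ∈ V)
    (hvw : IsRationalAngle v w) {t t' : Fin 2 → ℂ} (ht : IsRationalTuple V t)
    (ht' : IsRationalTuple V t') (hd : DisjointTuples t t')
    (h : Commensurable (t 0) v ↔ Commensurable (t' 0) v) : BoundedOrFamily V v w := by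
  have hc : Commensurable (t 0) (t 1) := (ht.2 0 1 (by decide)).commensurable
  have hc' : Commensurable (t' 0) (t' 1) := (ht'.2 0 1 (by decide)).commensurable
  have e01 : lineArg (t 0) ≠ lineArg (t 1) := ht.injective.ne (by decide)
  have e01' : lineArg (t' 0) ≠ lineArg (t' 1) := ht'.injective.ne (by decide)
  have hd' : ∀ i j, lineArg (t i) ≠ lineArg (t' j) := fun i j =>
    hd.lineArg_ne (ht.ne_zero i) (ht'.ne_zero j)
  have hm : ∀ i, ![t 0, t 1, t' 0, t' 1] i ∈ V := by
    intro l; fin_cases l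
    exacts [ht.1 0, ht.1 1, ht'.1 0, ht'.1 1]
  have hm0 : ∀ i, ![t 0, t 1, t' 0, t' 1] i ≠ 0 := by
    intro l; fin_cases l
    exacts [ht.ne_zero 0, ht.ne_zero 1, ht'.ne_zero 0, ht'.ne_zero 1]
  have hinj : Function.Injective fun i => lineArg (![t 0, t 1, t' 0, t' 1] i) := by
    have a := hd' 0 0
    have b := hd' 0 1
    have c := hd' 1 0
    have d := hd' 1 1
    intro l l' hl
    fin_cases l <;> fin_cases l' <;> simp_all [eq_comm]
  by_cases h0 : Commensurable (t 0) v
  · have h0' := h.1 h0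
    refine boundedOrFamily_of_commensurable hV hv hw hvw hm hm0 hinj ?_
    intro l; fin_cases l
    exacts [h0, hc.symm.trans (ht.ne_zero 0) h0, h0', hc'.symm.trans (ht'.ne_zero 0) h0']
  · have h0' : ¬ Commensurable (t' 0) v := fun h' => h0 (h.2 h')
    refine boundedOrFamily_of_not_commensurable hV hv hw hvw hm hm0 hinj hc hc' ?_
    intro l; fin_cases l
    exacts [h0, fun h1 => h0 (hc.trans (ht.ne_zero 1) h1), h0',
      fun h1 => h0' (hc'.trans (ht'.ne_zero 1) h1)]

/-- Pigeonhole: two of the three pairs are both commensurable with `v` or both not. -/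
theorem boundedOrFamily_of_three_pairs (hV : IsSpace V) (hv : v ∈ V) (hw : w ∈ V)
    (hvw : IsRationalAngle v w) {r s t : Fin 2 → ℂ} (hr : IsRationalTuple V r)
    (hs : IsRationalTuple V s) (ht : IsRationalTuple V t) (hrs : DisjointTuples r s)
    (hrt : DisjointTuples r t) (hst : DisjointTuples s t) : BoundedOrFamily V v w := by
  by_cases h : Commensurable (r 0) v ↔ Commensurable (s 0) v
  · exact boundedOrFamily_of_two_pairs hV hv hw hvw hr hs hrs h
  by_cases h' : Commensurable (r 0) v ↔ Commensurable (t 0) v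
  · exact boundedOrFamily_of_two_pairs hV hv hw hvw hr ht hrt h'
  · exact boundedOrFamily_of_two_pairs hV hv hw hvw hs ht hst (by tauto)

end Configurations

theorem boundedOrFamily_of_hasType {V : Submodule ℚ ℂ} (hV : IsSpace V)
    (hT : HasType V ![2, 2, 2] ∨ HasType V ![3, 2] ∨ HasType V ![4]) {v w : ℂ} (hv : v ∈ V)
    (hw : w ∈ V) (hvw : IsRationalAngle v w) : BoundedOrFamily V v w := by
  rcases hT with ⟨t, ht, hd⟩ | ⟨t, ht, hd⟩ | ⟨t, ht, -⟩
  · exact boundedOrFamily_of_three_pairs hV hv hw hvw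
      (show IsRationalTuple V (n := 2) (t 0) from ht 0)
      (show IsRationalTuple V (n := 2) (t 1) from ht 1)
      (show IsRationalTuple V (n := 2) (t 2) from ht 2)
      (hd 0 1 (by decide)) (hd 0 2 (by decide)) (hd 1 2 (by decide))
  · exact boundedOrFamily_of_triple_and_pair hV hv hw hvw
      (show IsRationalTuple V (n := 3) (t 0) from ht 0)
      (show IsRationalTuple V (n := 2) (t 1) from ht 1) (hd 0 1 (by decide))
  · exact boundedOrFamily_of_quadruple hV hv hw hvw
      (show IsRationalTuple V (n := 4) (t 0) from ht 0)

end RationalAngles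

/-! ### Numerical bound and conclusion -/

theorem two_mul_primorial_le_bound :
    2 * (48 * primorial 27) ≤
      2 ^ 7 * 3 ^ 4 * 5 ^ 3 * (∏ p ∈ Finset.Icc 7 37 with Nat.Prime p, p) ^ 2 := by
  have h1 : primorial 27 = 223092870 := by
    simp only [primorial, Finset.prod_filter, Finset.prod_range_succ]
    norm_num
  -- The primes from 7 to 23 already suffice.
  have h2 : 7 * 11 * 13 * 17 * 19 * 23 ≤ ∏ p ∈ Finset.Icc 7 37 with Nat.Prime p, p := by
    have hs : ({7, 11, 13, 17, 19, 23} : Finset ℕ) ⊆ (Finset.Icc 7 37).filter Nat.Prime := by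
      intro p hp
      simp only [Finset.mem_insert, Finset.mem_singleton] at hp
      rcases hp with rfl | rfl | rfl | rfl | rfl | rfl <;> simp <;> norm_num
    refine le_trans (le_of_eq (by simp)) (Finset.prod_le_prod_of_subset_of_one_le' hs ?_)
    intro p hp _
    exact (Finset.mem_filter.1 hp).2.one_le
  rw [h1]
  calc _ ≤ 2 ^ 7 * 3 ^ 4 * 5 ^ 3 * (7 * 11 * 13 * 17 * 19 * 23) ^ 2 := by norm_num
    _ ≤ _ := by gcongr

theorem theorem1p1 (V : Submodule ℚ ℂ) (hV : RationalAngles.IsSpace V)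
    (hT : RationalAngles.HasType V ![2, 2, 2] ∨ RationalAngles.HasType V ![3, 2] ∨
      RationalAngles.HasType V ![4]) :
    (∃ W : Submodule ℚ ℂ,
      (RationalAngles.InFirstFamily W ∨ RationalAngles.InSecondFamily W) ∧
        RationalAngles.Homothetic V W) ∨
    ∀ v ∈ V, ∀ w ∈ V, RationalAngles.IsRationalAngle v w →
      ∀ (a : ℤ) (b : ℕ), 0 < b → IsCoprime a (b : ℤ) →
        (Complex.arg (w / v) : Real.Angle) = (((a : ℝ) / (b : ℝ) * (2 * Real.pi) : ℝ) : Real.Angle) →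
        b ≤ 2 ^ 7 * 3 ^ 4 * 5 ^ 3 * (∏ p ∈ Finset.Icc 7 37 with Nat.Prime p, p) ^ 2 := by
  rw [or_iff_not_imp_left]
  intro hfam v hv w hw hvw a b hb hab harg
  obtain ⟨m, hm, hm', h⟩ :=
    (RationalAngles.boundedOrFamily_of_hasType hV hT hv hw hvw).resolve_right hfam
  have hd := RationalAngles.dvd_of_lineArg_pow_eq_one hvw.1 hvw.2.1 hb hab harg h
  exact (Nat.le_of_dvd (by omega) hd).trans
    ((Nat.mul_le_mul_left 2 hm').trans two_mul_primorial_le_bound)
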